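/- Let $\alpha\in\mathbb R\setminus\mathbb Q$ with continued fraction convergents $p_n/q_n$, and let $\beta(\alpha)=\limsup_{n\to\infty}\frac{\log q_{n+1}}{q_n}\in[0,\infty]$. Let $d\ge 1$ and let $v_d(x)=\sum_{k=-d}^{d}\hat v_k e^{2\pi i k x}$ be a real-valued trigonometric polynomial of degree $d$ (so $\hat v_{-k}=\overline{\hat v_k}$ and $\hat v_d\neq 0$). For $E\in\mathbb R$ let $L^{E,d}(x)\in\mathbb C^{2d\times 2d}$ be the transfer matrix of the long-range equation $\sum_{k=-d}^{d}\hat v_k u_{n+k}+2\cos(2\pi(x+n\alpha))u_n=Eu_n$: its first row is $$\frac1{\hat v_d}\bigl(-\hat v_{d-1},\dots,-\hat v_1,\;E-2\cos(2\pi x)-\hat v_0,\;-\hat v_{-1},\dots,-\hat v_{-d}\bigr),$$ its entries directly below the diagonal are $1$, and all its other entries are $0$. Let $C_d$ be the $d\times d$ upper triangular matrix with entries $(C_d)_{ij}=\hat v_{d-(j-i)}$ for $i\le j$, and let $$S_d=\begin{pmatrix}0&-C_d^*\\ C_d&0\end{pmatrix},\qquad J=\begin{pmatrix}0&1\\-1&0\end{pmatrix},\qquad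 \mathrm{HSp}(2d,2,\psi_d,\omega_1)=\{M\in\mathbb C^{2d\times 2}: M^*S_dM=J\}.$$ For $\epsilon>0$, $C^\omega_\epsilon(\mathbb R/\mathbb Z,*)$ denotes the $*$-valued functions on $\mathbb R/\mathbb Z$ that extend holomorphically to $\{|\operatorname{Im}x|<\epsilon\}$ (as $1$-periodic functions), and $\|F\|_\epsilon=\sup_{|\operatorname{Im}x|<\epsilon}\|F(x)\|$ with the spectral norm. For every $\epsilon>0$ and $c>0$ there exist $\delta_*>0$, $q_*>0$ and a subsequence $(p_{n_j}/q_{n_j})_j$ of the convergents of $\alpha$ such that the following holds. For every $j$ with $q_{n_j}>q_*$ and every $E\in\mathbb R$ with $|E|\le 3+\sup_{x\in\mathbb R}|v_d(x)|$, there are no $\rho\in C^\omega_\epsilon(\mathbb R/\mathbb Z,\mathbb R)$ and $B\in C^\omega_\epsilon(\mathbb R/\mathbb Z,\mathrm{HSp}(2d,2,\psi_d,\omega_1))$ with $$\bigl\|L^{E,d}(x)B(x)-B(x+\alpha)\,e^{2\pi i\rho(x)}I_2\bigr\|_\epsilon\le e^{(-c+\delta_*)q_{n_j}}\quad\text{and}\quad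 \|B\|_\epsilon\le e^{\delta_* q_{n_j}}.$$ Moreover, if $\beta(\alpha)>0$, then this subsequence also satisfies $q_{n_j+1}>e^{(\beta(\alpha)-o(1))q_{n_j}}$ (that is, for every real $b<\beta(\alpha)$ one has $q_{n_j+1}>e^{b\,q_{n_j}}$ for all large $j$), and the same statement, with the same $\delta_*$ and $q_*$, holds with $B(x+\alpha)$ replaced by $B(x+p_{n_j}/q_{n_j})$. -/

import Mathlib

open scoped ENNReal

noncomputable section

namespace LongRange

/-- The denominator `q_n` of the `n`-th continued fraction convergent of `α`. -/
def q (α : ℝ) (n : ℕ) : ℝ := (GenContFract.of α).dens n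

/-- The `n`-th continued fraction convergent `p_n / q_n` of `α`. -/
def conv (α : ℝ) (n : ℕ) : ℝ := (GenContFract.of α).convs n

/-- `β(α) = limsup (log q_{n+1}) / q_n`, with values in the extended reals (it may be `+∞`). -/
def beta (α : ℝ) : EReal :=
  Filter.limsup (fun n : ℕ => ((Real.log (q α (n + 1)) / q α n : ℝ) : EReal)) Filter.atTop

/-- `v : ℤ → ℂ` is the family of Fourier coefficients of a real-valued trigonometric polynomial of
degree exactly `d`. -/
structure IsRealTrigPoly (d : ℕ) (v : ℤ → ℂ) : Prop where
  real : ∀ k : ℤ, v (-k) = star (v k)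
  degree_le : ∀ k : ℤ, (d : ℤ) < |k| → v k = 0
  leading : v d ≠ 0

/-- The trigonometric polynomial `v_d(x) = ∑_{|k| ≤ d} v_k e^{2πikx}`. -/
def potential (d : ℕ) (v : ℤ → ℂ) (x : ℝ) : ℂ :=
  ∑ k ∈ Finset.Icc (-(d : ℤ)) d, v k * Complex.exp (2 * Real.pi * Complex.I * k * x)

/-- The transfer matrix `L^{E,d}(z)` of the eigenvalue equation
`∑_{|k| ≤ d} v_k u_{n+k} + 2 cos(2π(x + nα)) u_n = E u_n`, acting on the column
`(u_{n+d-1}, …, u_{n-d})`, so that the column with index `j` carries the coefficient `v_{d-1-j}`. -/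
def transfer (d : ℕ) (v : ℤ → ℂ) (E : ℝ) (z : ℂ) : Matrix (Fin (d + d)) (Fin (d + d)) ℂ :=
  Matrix.of fun i j =>
    if (i : ℕ) = 0 then
      ((if (j : ℕ) + 1 = d then (E : ℂ) - 2 * Complex.cos (2 * Real.pi * z) else 0)
        - v ((d : ℤ) - 1 - (j : ℕ))) / v d
    else if (i : ℕ) = (j : ℕ) + 1 then 1 else 0

/-- The upper triangular Toeplitz matrix `C_d` with first row `v_d, …, v_1`. -/
def toeplitzC (d : ℕ) (v : ℤ → ℂ) : Matrix (Fin d) (Fin d) ℂ :=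
  Matrix.of fun i j => if i ≤ j then v ((d : ℤ) + (i : ℕ) - (j : ℕ)) else 0

/-- The matrix `S_d = [[0, -C_d^*], [C_d, 0]]` of the Hermitian-symplectic form `ψ_d`. -/
def formS (d : ℕ) (v : ℤ → ℂ) : Matrix (Fin (d + d)) (Fin (d + d)) ℂ :=
  Matrix.reindex finSumFinEquiv finSumFinEquiv
    (Matrix.fromBlocks 0 (-(toeplitzC d v).conjTranspose) (toeplitzC d v) 0)

/-- The matrix of the standard form `ω_1` on `ℂ²`. -/
def formJ : Matrix (Fin 2) (Fin 2) ℂ := !![0, 1; -1, 0]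

/-- `HSp(2d, 2, ψ_d, ω_1)`. -/
def HSp (d : ℕ) (v : ℤ → ℂ) : Set (Matrix (Fin (d + d)) (Fin 2) ℂ) :=
  {M | M.conjTranspose * formS d v * M = formJ}

/-- The complex strip `|Im z| < ε`. -/
def strip (ε : ℝ) : Set ℂ := {z | |z.im| < ε}

/-- A complex-valued function on `ℝ/ℤ` with a holomorphic extension to the strip, given by that
extension. Only the values of `f` on the strip matter. -/
def IsStripAnalytic (ε : ℝ) (f : ℂ → ℂ) : Prop :=
  DifferentiableOn ℂ f (strip ε) ∧ ∀ z ∈ strip ε, f (z + 1) = f z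

open scoped Matrix.Norms.L2Operator in
/-- `‖F‖_ε`: the supremum over the strip of the spectral norm. -/
def stripNorm {m n : ℕ} (ε : ℝ) (F : ℂ → Matrix (Fin m) (Fin n) ℂ) : ℝ≥0∞ :=
  ⨆ z ∈ strip ε, ‖F z‖ₑ

/-- There are `ρ ∈ C^ω_ε(ℝ/ℤ, ℝ)` and `B ∈ C^ω_ε(ℝ/ℤ, HSp(2d, 2, ψ_d, ω_1))` with
`‖L^{E,d}(x) B(x) - B(x + ω) e^{2πiρ(x)} I₂‖_ε ≤ η` and `‖B‖_ε ≤ K`. -/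
def AlmostConjugate (d : ℕ) (v : ℤ → ℂ) (E ω ε η K : ℝ) : Prop :=
  ∃ (ρ : ℂ → ℂ) (B : ℂ → Matrix (Fin (d + d)) (Fin 2) ℂ),
    IsStripAnalytic ε ρ ∧ (∀ x : ℝ, (ρ x).im = 0) ∧
    (∀ i j, IsStripAnalytic ε fun z => B z i j) ∧ (∀ x : ℝ, B x ∈ HSp d v) ∧
    stripNorm ε (fun z => transfer d v E z * B z -
      B (z + ω) * (Complex.exp (2 * Real.pi * Complex.I * ρ z) • (1 : Matrix (Fin 2) (Fin 2) ℂ)))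
        ≤ ENNReal.ofReal η ∧
    stripNorm ε B ≤ ENNReal.ofReal K

end LongRange

end

noncomputable section

namespace LongRange

open Complex MeasureTheory

/-! The obstruction is the constancy of the Wronskian for second order difference equations: such an
equation cannot have two independent solutions decaying at infinity. By Aubry duality, a Fourier
coefficient of the central component of an invariant section with constant multiplier `l` solves
`f(m+1) + f(m-1) = c_m f(m)` with `c_m = E - v_d`, evaluated at `l e(mω)`. A section analytic on a
strip gives exponentially decaying coefficients, so the two columns of `B` would give two such
solutions.

Quantitatively, the Wronskian of the two approximate solutions is nearly constant and is tiny at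
time about `q`, hence tiny at `0`. Some combination `(a, b)` of sup norm one then almost vanishes at
the sites `0` and `1`; the recursion keeps it small nearby, decay makes it small far away, and
interpolation makes it small everywhere (`exists_small_combination`). Thus `B ξ` is small for some
`ξ` of norm one (`one_le_of_gauged_section`). This contradicts a lower bound for `B`: the identity
`B^* S B = J` continues to the strip and makes `B` quantitatively injective there
(`norm_le_mul_norm_mulVec`).

The multiplier `e(ρ)` must first be made constant. The bounds on `B` from both sides control the
imaginary parts of the Birkhoff sums of `ρ` up to a time `N` proportional to `q`
(`abs_im_birkhoff_le`). The cohomological equation for `ρ` is then solved up to frequency `q/2`,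
where the small divisors are at least `1/q` (`exists_gauge`). Dividing the coefficients of `ρ`
itself by `1/q` would allow a gauge of size `q^2`, which is too costly after exponentiation; using
all Birkhoff sums up to time `N` keeps the gauge of size a small multiple of `q`.

Only two facts about the frequency enter: divisors at least `1/q` for `|k| ≤ q/2`, and a uniform
lower bound for finitely many small `k`. Both hold for `α` and for its convergent with denominator
`q`, so every convergent of large denominator works, and the subsequence is needed only to realise
`β(α)`. -/

/-- The character `e(z) = e^{2πiz}`. -/
def ex (z : ℂ) : ℂ := Complex.exp (2 * Real.pi * Complex.I * z)

/-! ### The character and analytic functions on a strip -/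

theorem ex_add (z w : ℂ) : ex (z + w) = ex z * ex w := by
  simp only [ex, mul_add, Complex.exp_add]

theorem ex_zero : ex 0 = 1 := by simp [ex]

theorem ex_int (k : ℤ) : ex k = 1 := by
  rw [ex, Complex.exp_eq_one_iff]
  exact ⟨k, by ring⟩

theorem ex_nat_mul (n : ℕ) (z : ℂ) : ex (n * z) = ex z ^ n := by
  rw [ex, ex, ← Complex.exp_nat_mul]; congr 1; ring

theorem norm_ex (z : ℂ) : ‖ex z‖ = Real.exp (-(2 * Real.pi * z.im)) := by
  rw [ex, Complex.norm_exp]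
  simp

theorem norm_ex_ofReal (x : ℝ) : ‖ex x‖ = 1 := by
  rw [norm_ex]; simp

theorem norm_ex_of_im_eq_zero {z : ℂ} (h : z.im = 0) : ‖ex z‖ = 1 := by
  rw [norm_ex]; simp [h]

theorem differentiable_ex : Differentiable ℂ ex := by
  unfold ex; fun_prop

theorem continuous_ex : Continuous ex := differentiable_ex.continuous

theorem ofReal_mem_strip {ε : ℝ} (hε : 0 < ε) (x : ℝ) : (x : ℂ) ∈ strip ε := by
  simpa [strip] using hε

theorem add_ofReal_mem_strip {ε : ℝ} {z : ℂ} (hz : z ∈ strip ε) (x : ℝ) :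
    z + x ∈ strip ε := by
  simpa [strip] using hz

theorem isOpen_strip (ε : ℝ) : IsOpen (strip ε) :=
  isOpen_lt (by fun_prop) continuous_const

theorem convex_strip (ε : ℝ) : Convex ℝ (strip ε) := by
  have : strip ε = Complex.imLm ⁻¹' Set.Ioo (-ε) ε := by
    ext z; simp [strip, abs_lt]
  rw [this]
  exact (convex_Ioo _ _).linear_preimage _

theorem star_mem_strip {ε : ℝ} {z : ℂ} (hz : z ∈ strip ε) : star z ∈ strip ε := by
  simpa [strip] using hz

/-- Identity theorem on the strip: holomorphic functions agreeing on the real line agree. -/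
theorem eqOn_strip_of_eq_on_real {ε : ℝ} (hε : 0 < ε) {f g : ℂ → ℂ}
    (hf : DifferentiableOn ℂ f (strip ε)) (hg : DifferentiableOn ℂ g (strip ε))
    (h : ∀ x : ℝ, f x = g x) : Set.EqOn f g (strip ε) := by
  have h0 : (0 : ℂ) ∈ strip ε := by simpa [strip] using hε
  refine (hf.analyticOnNhd (isOpen_strip ε)).eqOn_of_preconnected_of_frequently_eq
    (hg.analyticOnNhd (isOpen_strip ε)) (convex_strip ε).isPreconnected h0 ?_
  -- The real points `1/(n+1)` accumulate at the interior point `0`.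
  have ht : Filter.Tendsto (fun n : ℕ => (((1 : ℝ) / ((n : ℝ) + 1) : ℝ) : ℂ)) Filter.atTop
      (nhdsWithin 0 {0}ᶜ) := by
    refine tendsto_nhdsWithin_iff.2 ⟨?_, Filter.Eventually.of_forall fun n => ?_⟩
    · have := (Complex.continuous_ofReal.tendsto 0).comp
        (tendsto_one_div_add_atTop_nhds_zero_nat (𝕜 := ℝ))
      simpa [Function.comp_def] using this
    · have : (0 : ℝ) < 1 / ((n : ℝ) + 1) := by positivity
      simpa using (by exact_mod_cast this.ne' : (((1 : ℝ) / ((n : ℝ) + 1) : ℝ) : ℂ) ≠ 0)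
  exact ht.frequently (Filter.Frequently.of_forall fun n => h _)

theorem differentiableOn_star_star {ε : ℝ} {f : ℂ → ℂ} (hf : DifferentiableOn ℂ f (strip ε)) :
    DifferentiableOn ℂ (fun z => star (f (star z))) (strip ε) := by
  intro z hz
  have h := (hf.differentiableAt ((isOpen_strip ε).mem_nhds (star_mem_strip hz))).star_star
  rw [star_star] at h
  exact h.differentiableWithinAt

/-- Schwarz reflection. -/
theorem star_eq_of_real {ε : ℝ} (hε : 0 < ε) {f : ℂ → ℂ} (hf : DifferentiableOn ℂ f (strip ε))
    (h : ∀ x : ℝ, (f x).im = 0) {z : ℂ} (hz : z ∈ strip ε) : f (star z) = star (f z) := by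
  have := eqOn_strip_of_eq_on_real hε (differentiableOn_star_star hf) hf (fun x => ?_) hz
  · rw [← this, star_star]
  · simp only [Complex.star_def, Complex.conj_ofReal]
    exact Complex.conj_eq_iff_im.2 (h x)

theorem IsStripAnalytic.continuous_comp {ε : ℝ} {f : ℂ → ℂ} (hf : IsStripAnalytic ε f)
    {y : ℝ} (hy : |y| < ε) : Continuous fun x : ℝ => f (x + y * I) := by
  refine hf.1.continuousOn.comp_continuous (by fun_prop) fun x => ?_
  simpa [strip] using hy

theorem IsStripAnalytic.continuous_ofReal {ε : ℝ} (hε : 0 < ε) {f : ℂ → ℂ}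
    (hf : IsStripAnalytic ε f) : Continuous fun x : ℝ => f x := by
  simpa using hf.continuous_comp (y := 0) (by simpa using hε)

theorem IsStripAnalytic.mul {ε : ℝ} {f g : ℂ → ℂ} (hf : IsStripAnalytic ε f)
    (hg : IsStripAnalytic ε g) : IsStripAnalytic ε fun z => f z * g z :=
  ⟨hf.1.mul hg.1, fun z hz => by simp only [hf.2 z hz, hg.2 z hz]⟩

theorem isStripAnalytic_ex_int_mul (ε : ℝ) (k : ℤ) : IsStripAnalytic ε fun z => ex (k * z) := by
  refine ⟨(differentiable_ex.comp (by fun_prop)).differentiableOn, fun z _ => ?_⟩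
  simp only [mul_add, ex_add, mul_one, ex_int]

theorem IsStripAnalytic.sum {ι : Type*} (s : Finset ι) {ε : ℝ} {f : ι → ℂ → ℂ}
    (hf : ∀ i ∈ s, IsStripAnalytic ε (f i)) : IsStripAnalytic ε fun z => ∑ i ∈ s, f i z :=
  ⟨DifferentiableOn.fun_sum fun i hi => (hf i hi).1,
    fun z hz => Finset.sum_congr rfl fun i hi => (hf i hi).2 z hz⟩

theorem IsStripAnalytic.const_mul {ε : ℝ} {f : ℂ → ℂ} (c : ℂ) (hf : IsStripAnalytic ε f) :
    IsStripAnalytic ε fun z => c * f z :=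
  ⟨hf.1.const_mul c, fun z hz => by simp only [hf.2 z hz]⟩

theorem IsStripAnalytic.ex_comp {ε : ℝ} {f : ℂ → ℂ} (hf : IsStripAnalytic ε f) :
    IsStripAnalytic ε fun z => ex (f z) :=
  ⟨differentiable_ex.comp_differentiableOn hf.1, fun z hz => by simp only [hf.2 z hz]⟩

theorem IsStripAnalytic.comp_add_ofReal {ε : ℝ} {f : ℂ → ℂ} (hf : IsStripAnalytic ε f) (a : ℝ) :
    IsStripAnalytic ε fun z => f (z + a) := by
  refine ⟨hf.1.comp (by fun_prop) fun z hz => add_ofReal_mem_strip hz a, fun z hz => ?_⟩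
  change f (z + 1 + a) = f (z + a)
  rw [← hf.2 _ (add_ofReal_mem_strip hz a)]; congr 1; ring

/-! ### Fourier coefficients and their decay -/

/-- The `k`-th Fourier coefficient of a function on `ℝ/ℤ`. -/
def fc (f : ℝ → ℂ) (k : ℤ) : ℂ := ∫ x in (0 : ℝ)..1, f x * ex (-(k * x))

theorem continuous_ex_neg_int_mul (k : ℤ) : Continuous fun x : ℝ => ex (-(k * x)) :=
  continuous_ex.comp (by fun_prop)

theorem fc_add {f g : ℝ → ℂ} (hf : Continuous f) (hg : Continuous g) (k : ℤ) :
    fc (fun x => f x + g x) k = fc f k + fc g k := by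
  simp only [fc, add_mul]
  exact intervalIntegral.integral_add
    ((hf.mul (continuous_ex_neg_int_mul k)).intervalIntegrable _ _)
    ((hg.mul (continuous_ex_neg_int_mul k)).intervalIntegrable _ _)

theorem fc_sub {f g : ℝ → ℂ} (hf : Continuous f) (hg : Continuous g) (k : ℤ) :
    fc (fun x => f x - g x) k = fc f k - fc g k := by
  simp only [fc, sub_mul]
  exact intervalIntegral.integral_sub
    ((hf.mul (continuous_ex_neg_int_mul k)).intervalIntegrable _ _)
    ((hg.mul (continuous_ex_neg_int_mul k)).intervalIntegrable _ _)

theorem fc_const_mul (c : ℂ) (f : ℝ → ℂ) (k : ℤ) :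
    fc (fun x => c * f x) k = c * fc f k := by
  simp only [fc, mul_assoc]
  exact intervalIntegral.integral_const_mul _ _

theorem fc_sum {ι : Type*} (s : Finset ι) {f : ι → ℝ → ℂ} (hf : ∀ i ∈ s, Continuous (f i))
    (k : ℤ) : fc (fun x => ∑ i ∈ s, f i x) k = ∑ i ∈ s, fc (f i) k := by
  simp only [fc, Finset.sum_mul]
  exact intervalIntegral.integral_finsetSum fun i hi =>
    ((hf i hi).mul (continuous_ex_neg_int_mul k)).intervalIntegrable _ _

theorem norm_fc_le {f : ℝ → ℂ} {C : ℝ} (hf : ∀ x, ‖f x‖ ≤ C) (k : ℤ) : ‖fc f k‖ ≤ C := by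
  have := intervalIntegral.norm_integral_le_of_norm_le_const (a := 0) (b := 1)
    (f := fun x : ℝ => f x * ex (-(k * x))) (C := C) fun x _ => by
      rw [norm_mul, norm_ex_of_im_eq_zero (by simp), mul_one]; exact hf x
  simpa [fc] using this

theorem fc_comp_add {f : ℝ → ℂ} (hp : Function.Periodic f 1) (a : ℝ) (k : ℤ) :
    fc (fun x => f (x + a)) k = ex (k * a) * fc f k := by
  have h1 : ∀ x : ℝ, f (x + a) * ex (-(k * x))
      = ex (k * a) * (fun x : ℝ => f x * ex (-(k * x))) (x + a) := by
    intro x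
    have : ex (-(k * x)) = ex (k * a) * ex (-(k * ((x + a : ℝ) : ℂ))) := by
      rw [← ex_add]; congr 1; push_cast; ring
    simp only [this]; ring
  simp only [fc]
  simp_rw [h1]
  rw [intervalIntegral.integral_const_mul,
    intervalIntegral.integral_comp_add_right (fun x : ℝ => f x * ex (-(k * x)))]
  congr 1
  have hper : Function.Periodic (fun x : ℝ => f x * ex (-(k * x))) 1 := by
    intro x
    simp only [hp x]
    congr 1
    have : (-(k * ((x + 1 : ℝ) : ℂ))) = -(k * x) + ((-k : ℤ) : ℂ) := by push_cast; ring
    rw [this, ex_add, ex_int, mul_one]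
  have := hper.intervalIntegral_add_eq a 0
  simpa [add_comm] using this

theorem fc_mul_ex_int {f : ℝ → ℂ} (j k : ℤ) :
    fc (fun x => ex (j * x) * f x) k = fc f (k - j) := by
  simp only [fc]
  congr 1; ext x
  have : ex (-(((k - j : ℤ) : ℂ) * x)) = ex (j * x) * ex (-(k * x)) := by
    rw [← ex_add]; congr 1; push_cast; ring
  rw [this]; ring

theorem fc_ex_int (j k : ℤ) : fc (fun x => ex (j * x)) k = if j = k then 1 else 0 := by
  have h := fc_mul_ex_int (f := fun _ => 1) j k
  simp only [mul_one] at h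
  rw [h]
  simp only [fc, one_mul]
  split_ifs with hjk
  · simp [hjk, ex_zero]
  · have hc : (2 * Real.pi * I * (-(((k - j : ℤ) : ℂ)))) ≠ 0 := by
      have : ((k - j : ℤ) : ℂ) ≠ 0 := by exact_mod_cast sub_ne_zero.2 (Ne.symm hjk)
      simp [this, Real.pi_ne_zero, -Int.cast_sub]
    have h2 : ∀ x : ℝ, ex (-(((k - j : ℤ) : ℂ) * x))
        = Complex.exp ((2 * Real.pi * I * (-(((k - j : ℤ) : ℂ)))) * x) := by
      intro x; rw [ex]; congr 1; ring
    simp_rw [h2]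
    rw [integral_exp_mul_complex hc]
    have h3 : Complex.exp ((2 * Real.pi * I * (-(((k - j : ℤ) : ℂ)))) * ((1 : ℝ) : ℂ)) = 1 := by
      have := ex_int (-(k - j))
      rw [ex] at this
      rw [← this]; congr 1; push_cast; ring
    rw [h3]; simp

/-- Shifting the contour of integration in a Fourier coefficient. -/
theorem fc_shift {ε : ℝ} {f : ℂ → ℂ} (hf : IsStripAnalytic ε f) {y : ℝ}
    (hy : |y| < ε) (k : ℤ) :
    fc (fun x => f (x + y * I)) k = Complex.exp (-(2 * Real.pi * k * y)) * fc (fun x => f x) k := by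
  -- Cauchy's theorem on the rectangle with opposite corners `0` and `1 + iy`; the vertical sides
  -- cancel by periodicity.
  have hF := hf.mul (isStripAnalytic_ex_int_mul ε (-k))
  have hsub : (Set.uIcc (0 : ℂ).re (1 + y * I).re ×ℂ
      Set.uIcc (0 : ℂ).im (1 + y * I).im) ⊆ strip ε := by
    intro z hz
    have h2 : z.im ∈ Set.uIcc (0 : ℂ).im (1 + y * I).im := hz.2
    simp only [zero_im, add_im, one_im, mul_im, ofReal_re, I_im, mul_one, ofReal_im, I_re,
      mul_zero, add_zero, zero_add] at h2
    have h3 := Set.abs_sub_left_of_mem_uIcc h2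
    simp only [sub_zero] at h3
    exact h3.trans_lt hy
  have h := Complex.integral_boundary_rect_eq_zero_of_differentiableOn _ 0 (1 + y * I)
    (hF.1.mono hsub)
  simp only [zero_re, add_re, one_re, mul_re, ofReal_re, I_re, mul_zero, ofReal_im, I_im, mul_one,
    sub_self, add_zero, zero_im, ofReal_zero, zero_mul, add_im, one_im, mul_im, zero_add,
    ofReal_one] at h
  have hv : ∀ t ∈ Set.uIcc 0 y, f (1 + t * I) * ex ((-k : ℤ) * (1 + t * I))
      = f (t * I) * ex ((-k : ℤ) * (t * I)) := by
    intro t ht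
    have h3 := Set.abs_sub_left_of_mem_uIcc ht
    simp only [sub_zero] at h3
    have hz : (t * I : ℂ) ∈ strip ε := by simpa [strip] using h3.trans_lt hy
    have := hF.2 _ hz
    rwa [add_comm] at this
  rw [intervalIntegral.integral_congr hv] at h
  have h4 : (∫ x in (0 : ℝ)..1, f x * ex ((-k : ℤ) * x)) = fc (fun x => f x) k := by
    simp [fc]
  have h5 : (∫ x in (0 : ℝ)..1, f (x + y * I) * ex ((-k : ℤ) * (x + y * I)))
      = Complex.exp (2 * Real.pi * k * y) * fc (fun x => f (x + y * I)) k := by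
    rw [← fc_const_mul]
    simp only [fc]
    congr 1; ext x
    have : ex ((-k : ℤ) * (x + y * I)) = Complex.exp (2 * Real.pi * k * y) * ex (-(k * x)) := by
      rw [ex, ex, ← Complex.exp_add]
      congr 1
      have hI := I_mul_I
      push_cast
      linear_combination (-(2 * Real.pi * k * y) : ℂ) * hI
    rw [this]; ring
  rw [h4, h5] at h
  have h6 : fc (fun x => f x) k
      = Complex.exp (2 * Real.pi * k * y) * fc (fun x => f (x + y * I)) k := by
    linear_combination h
  rw [h6, ← mul_assoc, ← Complex.exp_add]; simp

/-- Exponential decay of the Fourier coefficients of a function bounded on a strip. -/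
theorem norm_fc_le_of_strip {ε : ℝ} {f : ℂ → ℂ} (hf : IsStripAnalytic ε f) {y K : ℝ} (hy0 : 0 ≤ y)
    (hy : y < ε) (hK : ∀ z : ℂ, |z.im| ≤ y → ‖f z‖ ≤ K) (k : ℤ) :
    ‖fc (fun x => f x) k‖ ≤ K * Real.exp (-(2 * Real.pi * y * |(k : ℝ)|)) := by
  -- The contour moves to height `-y` or `y`, with sign opposite to that of `k`.
  have key : ∀ s : ℝ, |s| = y → 2 * Real.pi * k * s = - (2 * Real.pi * y * |(k : ℝ)|) →
      ‖fc (fun x => f x) k‖ ≤ K * Real.exp (-(2 * Real.pi * y * |(k : ℝ)|)) := by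
    intro s hs hks
    have h1 := fc_shift hf (y := s) (by rw [hs]; exact hy) k
    have h2 : ‖fc (fun x => f (x + s * I)) k‖ ≤ K :=
      norm_fc_le (fun x => hK _ (by simp [hs])) k
    have h3 : (-(2 * Real.pi * k * s) : ℂ) = ((-(2 * Real.pi * k * s) : ℝ) : ℂ) := by
      push_cast; ring
    rw [h1, norm_mul, h3, ← Complex.ofReal_exp, Complex.norm_real, Real.norm_eq_abs,
      Real.abs_exp, hks, neg_neg] at h2
    rw [Real.exp_neg, ← div_eq_mul_inv, le_div_iff₀ (Real.exp_pos _)]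
    linarith
  rcases le_total 0 (k : ℝ) with h | h
  · exact key (-y) (by rw [abs_neg, abs_of_nonneg hy0]) (by rw [abs_of_nonneg h]; ring)
  · exact key y (abs_of_nonneg hy0) (by rw [abs_of_nonpos h]; ring)

/-- Decay of the Fourier coefficients of a function whose imaginary part is bounded on a strip. -/
theorem norm_fc_le_of_im {ε : ℝ} {f : ℂ → ℂ} (hf : IsStripAnalytic ε f)
    (hreal : ∀ x : ℝ, (f x).im = 0) {y Θ : ℝ} (hy0 : 0 < y)
    (hy : y < ε) (hK : ∀ z : ℂ, |z.im| ≤ y → |(f z).im| ≤ Θ) {k : ℤ} (hk : k ≠ 0) :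
    ‖fc (fun x => f x) k‖ ≤
      2 / (1 - Real.exp (-(4 * Real.pi * y))) * Θ * Real.exp (-(2 * Real.pi * y * |(k : ℝ)|)) := by
  have hyy : |y| < ε := by rwa [abs_of_pos hy0]
  have hyn : |-y| < ε := by rwa [abs_neg]
  have h1 := fc_shift hf hyy k
  have h2 := fc_shift hf hyn k
  -- By Schwarz reflection, the difference of `f` at conjugate points is `2i Im f`, so no bound on
  -- the real part is needed. On the Fourier side the difference multiplies the coefficient by a
  -- factor of modulus `X - X⁻¹`, which is bounded away from zero because `|k| ≥ 1`.
  have h3 : ‖fc (fun x => f (x + y * I) - f (x + (-y : ℝ) * I)) k‖ ≤ 2 * Θ := by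
    refine norm_fc_le (fun x => ?_) k
    have hz : ((x : ℂ) + y * I) ∈ strip ε := by simpa [strip] using hyy
    have hs : (x : ℂ) + (-y : ℝ) * I = star ((x : ℂ) + y * I) := by
      apply Complex.ext <;> simp
    rw [hs, star_eq_of_real (hy0.trans hy) hf.1 hreal hz, Complex.star_def, Complex.sub_conj]
    have := hK (x + y * I) (by simp [abs_of_pos hy0])
    simp only [norm_mul, norm_real, norm_I, mul_one, Real.norm_eq_abs, abs_two]
    linarith
  rw [fc_sub (hf.continuous_comp hyy) (hf.continuous_comp hyn), h1, h2, ← sub_mul, norm_mul] at h3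
  set X := Real.exp (2 * Real.pi * y * |(k : ℝ)|) with hX
  have hX0 : 0 < X := Real.exp_pos _
  have h4 : ‖Complex.exp (-(2 * Real.pi * k * y)) - Complex.exp (-(2 * Real.pi * k * (-y : ℝ)))‖
      = X - X⁻¹ := by
    have e1 : (-(2 * Real.pi * k * y) : ℂ) = ((-(2 * Real.pi * k * y) : ℝ) : ℂ) := by
      push_cast; ring
    have e2 : (-(2 * Real.pi * k * (-y : ℝ)) : ℂ) = ((2 * Real.pi * k * y : ℝ) : ℂ) := by
      push_cast; ring
    rw [e1, e2, ← Complex.ofReal_exp, ← Complex.ofReal_exp, ← Complex.ofReal_sub,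
      Complex.norm_real, Real.norm_eq_abs, hX, ← Real.exp_neg]
    have hpy : 0 < 2 * Real.pi * y := by positivity
    rcases le_total 0 (k : ℝ) with h | h
    · have hm : 0 ≤ 2 * Real.pi * k * y := by positivity
      rw [abs_of_nonneg h, abs_sub_comm, abs_of_nonneg]
      · congr 2 <;> ring
      · rw [sub_nonneg, Real.exp_le_exp]; linarith
    · have hm : 2 * Real.pi * k * y ≤ 0 := by nlinarith
      rw [abs_of_nonpos h, abs_of_nonneg]
      · congr 2 <;> ring
      · rw [sub_nonneg, Real.exp_le_exp]; linarith
  have hk1 : (1 : ℝ) ≤ |(k : ℝ)| := by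
    have := Int.one_le_abs hk
    exact_mod_cast this
  have h5 : X * (1 - Real.exp (-(4 * Real.pi * y))) ≤ X - X⁻¹ := by
    have : X⁻¹ ≤ X * Real.exp (-(4 * Real.pi * y)) := by
      rw [hX, ← Real.exp_neg, ← Real.exp_add, Real.exp_le_exp]
      have hpy : 0 < 2 * Real.pi * y := by positivity
      nlinarith
    linarith
  have h6 : 0 < 1 - Real.exp (-(4 * Real.pi * y)) := by
    rw [sub_pos, Real.exp_lt_one_iff]
    have : 0 < 4 * Real.pi * y := by positivity
    linarith
  rw [h4] at h3
  have h7 : X * (1 - Real.exp (-(4 * Real.pi * y))) * ‖fc (fun x => f x) k‖ ≤ 2 * Θ :=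
    (mul_le_mul_of_nonneg_right h5 (norm_nonneg _)).trans h3
  rw [Real.exp_neg (2 * Real.pi * y * |(k : ℝ)|), ← hX, div_mul_eq_mul_div,
    ← div_eq_mul_inv, div_div, le_div_iff₀ (by positivity)]
  linarith

/-- A continuous periodic function is bounded by the `ℓ¹` norm of its Fourier coefficients. -/
theorem norm_le_tsum_fc {f : ℝ → ℂ} (hf : Continuous f) (hp : Function.Periodic f 1)
    (hs : Summable fun k => ‖fc f k‖) (x : ℝ) : ‖f x‖ ≤ ∑' k, ‖fc f k‖ := by
  have : Fact (0 < (1 : ℝ)) := ⟨one_pos⟩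
  let F : C(AddCircle (1 : ℝ), ℂ) := ⟨hp.lift, continuous_coinduced_dom.2 hf⟩
  have hF : ∀ x : ℝ, F (x : AddCircle (1 : ℝ)) = f x := fun x => rfl
  have hc : ∀ k, fourierCoeff F k = fc f k := by
    intro k
    rw [fourierCoeff_eq_intervalIntegral _ _ 0]
    simp only [fc, zero_add, div_one, one_smul]
    congr 1; ext t
    rw [hF, fourier_coe_apply, smul_eq_mul, mul_comm, ex]
    congr 2; push_cast; ring
  have hsum : Summable (fourierCoeff F) := by
    refine Summable.of_norm ?_
    simpa only [hc] using hs
  have h := has_pointwise_sum_fourier_series_of_summable hsum (x : AddCircle (1 : ℝ))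
  rw [← hF x, ← h.tsum_eq]
  have hn : ∀ k, ‖fourierCoeff F k • fourier k (x : AddCircle (1 : ℝ))‖ = ‖fc f k‖ := by
    intro k
    rw [norm_smul, hc, fourier_coe_apply]
    have : ‖Complex.exp (2 * Real.pi * I * k * x / (1 : ℝ))‖ = 1 := by
      rw [Complex.norm_exp]; simp
    rw [this, mul_one]
  refine (norm_tsum_le_tsum_norm (by simpa only [hn] using hs)).trans_eq ?_
  simp only [hn]

/-! ### Small divisors and the cohomological equation -/

theorem conj_ex (z : ℂ) : (starRingEnd ℂ) (ex z) = ex (-(starRingEnd ℂ) z) := by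
  rw [ex, ex, ← Complex.exp_conj]
  congr 1
  simp [Complex.conj_ofNat]

/-- While all powers of a unimodular `e` stay within distance one of `1`, their real parts are at
least `1/2`, so the geometric sum has no cancellation. -/
theorem half_mul_norm_sub_one_le {e : ℂ} (he : ‖e‖ = 1) (N : ℕ)
    (h : ∀ j ≤ N, ‖e ^ j - 1‖ ≤ 1) : N * ‖e - 1‖ / 2 ≤ ‖e ^ N - 1‖ := by
  have hre : ∀ j ≤ N, (1 / 2 : ℝ) ≤ (e ^ j).re := by
    intro j hj
    have h1 : ‖e ^ j‖ = 1 := by rw [norm_pow, he, one_pow]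
    have h2 := h j hj
    have h3 : ‖e ^ j - 1‖ ^ 2 ≤ 1 := by
      have := norm_nonneg (e ^ j - 1); nlinarith
    have h4 : ‖e ^ j‖ ^ 2 = 1 := by rw [h1]; norm_num
    rw [Complex.sq_norm, Complex.normSq_apply] at h3 h4
    simp only [sub_re, one_re, sub_im, one_im, sub_zero] at h3
    nlinarith
  have h5 : (N : ℝ) / 2 ≤ ‖∑ i ∈ Finset.range N, e ^ i‖ := by
    refine le_trans ?_ (Complex.re_le_norm _)
    rw [Complex.re_sum]
    have := Finset.sum_le_sum (s := Finset.range N) (f := fun _ => (1 / 2 : ℝ))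
      (g := fun i => (e ^ i).re) fun i hi => hre i (Finset.mem_range.1 hi).le
    simp only [Finset.sum_const, Finset.card_range, nsmul_eq_mul] at this
    linarith
  rw [← geom_sum_mul, norm_mul]
  have := mul_le_mul_of_nonneg_right h5 (norm_nonneg (e - 1))
  linarith

/-- Bounds for a small divisor quotient `a / (e - 1)` out of bounds for the partial Birkhoff
sums `a * ∑_{i < j} e ^ i`. -/
theorem norm_div_sub_one_le {e a : ℂ} (he : ‖e‖ = 1) (he1 : e ≠ 1) {N : ℕ} {X : ℝ}
    (h : ∀ j ≤ N, ‖a‖ * ‖∑ i ∈ Finset.range j, e ^ i‖ ≤ X) :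
    ‖a / (e - 1)‖ ≤ X ∨
      ‖a / (e - 1)‖ * (N * ‖e - 1‖ / 2) ≤ X ∧ N * ‖e - 1‖ ≤ 4 := by
  have hX : 0 ≤ X := by simpa using h 0 (Nat.zero_le _)
  have hn : 0 < ‖e - 1‖ := norm_pos_iff.2 (sub_ne_zero.2 he1)
  -- Since `(e^j - 1)/(e - 1)` is the geometric sum, a single `j` with `‖e^j - 1‖ > 1` already
  -- bounds the quotient without loss. Otherwise the powers never leave the unit disc around `1`,
  -- and `e` is within `4/N` of `1`.
  have key : ∀ j ≤ N, ‖a / (e - 1)‖ * ‖e ^ j - 1‖ ≤ X := by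
    intro j hj
    rw [← geom_sum_mul, norm_mul, norm_div]
    calc _ = ‖a‖ * ‖∑ i ∈ Finset.range j, e ^ i‖ := by field_simp
      _ ≤ X := h j hj
  by_cases hex : ∀ j ≤ N, ‖e ^ j - 1‖ ≤ 1
  · right
    have h2 := half_mul_norm_sub_one_le he N hex
    refine ⟨(mul_le_mul_of_nonneg_left h2 (norm_nonneg _)).trans (key N le_rfl), ?_⟩
    have := hex N le_rfl
    linarith
  · left
    push Not at hex
    obtain ⟨j, hj, hj1⟩ := hex
    have := key j hj
    have := norm_nonneg (a / (e - 1))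
    nlinarith

theorem fc_neg_of_real {f : ℝ → ℂ} (h : ∀ x, (f x).im = 0) (k : ℤ) :
    fc f (-k) = star (fc f k) := by
  simp only [fc, Complex.star_def]
  rw [intervalIntegral.integral_of_le zero_le_one, intervalIntegral.integral_of_le zero_le_one,
    ← integral_conj]
  congr 1; ext x
  rw [map_mul, Complex.conj_eq_iff_im.2 (h x), conj_ex]
  congr 2
  simp

theorem summable_exp_neg_mul_abs {s : ℝ} (hs : 0 < s) :
    Summable fun k : ℤ => Real.exp (-(s * |(k : ℝ)|)) := by
  have h : Summable fun n : ℕ => Real.exp (-(s * n)) := by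
    have := Real.summable_exp_nat_mul_iff (a := -s)
    simp only [Left.neg_neg_iff] at this
    refine (this.2 hs).congr fun n => ?_
    congr 1; ring
  refine Summable.of_nat_of_neg ?_ ?_
  · simpa using h
  · simpa using h

/-- The total mass `∑_k e^{-s|k|}`. -/
def expMass (s : ℝ) : ℝ := ∑' k : ℤ, Real.exp (-(s * |(k : ℝ)|))

theorem expMass_nonneg (s : ℝ) : 0 ≤ expMass s := tsum_nonneg fun _ => (Real.exp_pos _).le

theorem im_eq_zero_of_symmetric_sum {M : ℤ} {b : ℤ → ℂ} (hb : ∀ k, b (-k) = star (b k)) (x : ℝ) :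
    (∑ k ∈ Finset.Icc (-M) M, b k * ex (k * x)).im = 0 := by
  rw [← Complex.conj_eq_iff_im, map_sum]
  refine Finset.sum_nbij' (fun k => -k) (fun k => -k) ?_ ?_ (by simp) (by simp) ?_
  · intro k hk; simp only [Finset.mem_Icc] at hk ⊢; omega
  · intro k hk; simp only [Finset.mem_Icc] at hk ⊢; omega
  · intro k _
    rw [hb, map_mul, Complex.star_def]
    congr 1
    rw [conj_ex]
    congr 1; simp

/-- Approximate solution of the cohomological equation `ρ = a₀ + g(· + ω) - g`, with bounds in
terms of the Birkhoff sums of `Im ρ` up to time `N`. -/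
theorem exists_gauge {ε y : ℝ} (hy0 : 0 < y) (hy : y < ε) {ρ : ℂ → ℂ} (hρ : IsStripAnalytic ε ρ)
    (hreal : ∀ x : ℝ, (ρ x).im = 0) (ω : ℝ) {N M K₀ : ℕ} (hN : 0 < N) {Θ τ : ℝ} (hτ0 : 0 < τ)
    (hΘ : ∀ j ≤ N, ∀ z : ℂ, |z.im| ≤ y → |(∑ i ∈ Finset.range j, ρ (z + (i * ω : ℝ))).im| ≤ Θ)
    (hdiv : ∀ k : ℤ, k ≠ 0 → |k| ≤ M → τ ≤ N * ‖ex (k * ω) - 1‖)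
    (hlow : ∀ k : ℤ, k ≠ 0 → |k| ≤ K₀ → 4 < N * ‖ex (k * ω) - 1‖)
    (hK₀ : 2 / τ * Real.exp (-(Real.pi * y / 2 * K₀)) ≤ 1) :
    ∃ (g : ℂ → ℂ) (a₀ : ℝ), (∀ ε', IsStripAnalytic ε' g) ∧ (∀ x : ℝ, (g x).im = 0) ∧
      (∀ z : ℂ, |z.im| ≤ y / 2 → ‖g z‖ ≤
        2 / (1 - Real.exp (-(4 * Real.pi * y))) * Θ * expMass (Real.pi * y / 2)) ∧
      ∀ x : ℝ, ‖ρ x - a₀ - (g (x + ω) - g x)‖ ≤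
        2 / (1 - Real.exp (-(4 * Real.pi * y))) * Θ * expMass (Real.pi * y / 2) *
          Real.exp (-(Real.pi * y / 2 * M)) := by
  have hε : 0 < ε := hy0.trans hy
  set Cy := 2 / (1 - Real.exp (-(4 * Real.pi * y))) with hCy
  have hCy0 : 0 < Cy := by
    refine div_pos two_pos ?_
    rw [sub_pos, Real.exp_lt_one_iff]
    have : 0 < 4 * Real.pi * y := by positivity
    linarith
  have hΘ0 : 0 ≤ Θ := (abs_nonneg _).trans (hΘ 0 (Nat.zero_le _) 0 (by simpa using hy0.le))
  -- The decay rate on the strip is `2πy = 4s`. One `s` pays for the small divisor, `2s` for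
  -- evaluating `g` on `|Im z| ≤ y/2`, and the last `s` keeps the sum convergent. In the remainder,
  -- one `s` yields `e^{-sM}` and another gives convergence.
  set s := Real.pi * y / 2 with hs
  have hs0 : 0 < s := by positivity
  set a : ℤ → ℂ := fc fun x => ρ x with ha
  have hastar : ∀ k, a (-k) = star (a k) := fc_neg_of_real hreal
  have hρp : Function.Periodic (fun x : ℝ => ρ x) 1 := by
    intro x
    have := hρ.2 x (ofReal_mem_strip hε x)
    simpa using this
  have hρc : Continuous fun x : ℝ => ρ x := hρ.continuous_ofReal hε
  -- the Fourier coefficients of the Birkhoff sums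
  have hbirk : ∀ j ≤ N, ∀ k : ℤ, k ≠ 0 → ‖a k‖ * ‖∑ i ∈ Finset.range j, ex (k * ω) ^ i‖ ≤
      Cy * Θ * Real.exp (-(4 * s * |(k : ℝ)|)) := by
    intro j hj k hk
    have h1 : IsStripAnalytic ε fun z => ∑ i ∈ Finset.range j, ρ (z + (i * ω : ℝ)) :=
      IsStripAnalytic.sum _ fun i _ => hρ.comp_add_ofReal _
    have h2 := norm_fc_le_of_im h1 (fun x => by
      rw [Complex.im_sum]
      refine Finset.sum_eq_zero fun i _ => ?_
      rw [← Complex.ofReal_add]; exact hreal _) hy0 hy (hΘ j hj) hk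
    have h3 : fc (fun x : ℝ => ∑ i ∈ Finset.range j, ρ (x + (i * ω : ℝ))) k
        = a k * ∑ i ∈ Finset.range j, ex (k * ω) ^ i := by
      rw [fc_sum _ (fun i _ => (hρ.comp_add_ofReal _).continuous_ofReal hε), Finset.mul_sum]
      refine Finset.sum_congr rfl fun i _ => ?_
      have := fc_comp_add hρp (i * ω) k
      simp only [Complex.ofReal_add] at this
      rw [this, mul_comm, ← ex_nat_mul]
      congr 2; push_cast; ring
    rw [h3, norm_mul] at h2
    refine h2.trans_eq ?_
    rw [hs, hCy]
    congr 3; ring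
  have hak : ∀ k : ℤ, k ≠ 0 → ‖a k‖ ≤ Cy * Θ * Real.exp (-(4 * s * |(k : ℝ)|)) := by
    intro k hk
    simpa using hbirk 1 hN k hk
  set b : ℤ → ℂ := fun k => if k = 0 then 0 else a k / (ex (k * ω) - 1) with hb
  have hb0 : b 0 = 0 := by simp [hb]
  have hbk : ∀ k : ℤ, k ≠ 0 → b k = a k / (ex (k * ω) - 1) := fun k hk => by simp [hb, hk]
  have hne : ∀ k : ℤ, k ≠ 0 → |k| ≤ M → ex (k * ω) ≠ 1 := by
    intro k hk hkM h
    have := hdiv k hk hkM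
    rw [h] at this
    simp only [sub_self, norm_zero, mul_zero] at this
    linarith
  have hbbound : ∀ k : ℤ, |k| ≤ M → ‖b k‖ ≤ Cy * Θ * Real.exp (-(3 * s * |(k : ℝ)|)) := by
    intro k hkM
    by_cases hk : k = 0
    · rw [hk, hb0, norm_zero]; positivity
    rw [hbk k hk]
    have hnorm : ‖ex (k * ω)‖ = 1 := norm_ex_of_im_eq_zero (by simp)
    have hmono : Real.exp (-(4 * s * |(k : ℝ)|)) ≤ Real.exp (-(3 * s * |(k : ℝ)|)) := by
      rw [Real.exp_le_exp]
      have := mul_nonneg hs0.le (abs_nonneg (k : ℝ))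
      linarith
    rcases norm_div_sub_one_le hnorm (hne k hk hkM) (fun j hj => hbirk j hj k hk) with h | ⟨h, h4⟩
    · exact h.trans (mul_le_mul_of_nonneg_left hmono (by positivity))
    -- The lossy alternative has `N ‖e - 1‖ ≤ 4`, which `hlow` excludes for small `k`. For `|k| ≥
    -- K₀` the loss `2/τ` is absorbed by `e^{-s|k|}`, so the final bound does not involve `τ`.
    · have hkK : (K₀ : ℝ) ≤ |(k : ℝ)| := by
        by_contra hcon
        push Not at hcon
        have : |k| ≤ K₀ := by
          have : |k| < (K₀ : ℤ) := by exact_mod_cast hcon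
          exact this.le
        have := hlow k hk this
        linarith
      have hd := hdiv k hk hkM
      set t := ‖a k / (ex (k * ω) - 1)‖ with ht
      have ht0 : 0 ≤ t := norm_nonneg _
      have h6 : t * (τ / 2) ≤ Cy * Θ * Real.exp (-(4 * s * |(k : ℝ)|)) :=
        (mul_le_mul_of_nonneg_left (by linarith) ht0).trans h
      have h7 : 2 / τ * Real.exp (-(4 * s * |(k : ℝ)|)) ≤ Real.exp (-(3 * s * |(k : ℝ)|)) := by
        have e1 : Real.exp (-(4 * s * |(k : ℝ)|))
            = Real.exp (-(s * |(k : ℝ)|)) * Real.exp (-(3 * s * |(k : ℝ)|)) := by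
          rw [← Real.exp_add]; congr 1; ring
        rw [e1, ← mul_assoc]
        refine mul_le_of_le_one_left (Real.exp_pos _).le (le_trans ?_ hK₀)
        refine mul_le_mul_of_nonneg_left ?_ (by positivity)
        rw [Real.exp_le_exp]
        have := mul_le_mul_of_nonneg_left hkK hs0.le
        linarith
      calc t = 2 / τ * (t * (τ / 2)) := by field_simp
        _ ≤ 2 / τ * (Cy * Θ * Real.exp (-(4 * s * |(k : ℝ)|))) :=
          mul_le_mul_of_nonneg_left h6 (by positivity)
        _ = Cy * Θ * (2 / τ * Real.exp (-(4 * s * |(k : ℝ)|))) := by ring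
        _ ≤ _ := mul_le_mul_of_nonneg_left h7 (by positivity)
  have hbstar : ∀ k, b (-k) = star (b k) := by
    intro k
    by_cases hk : k = 0
    · simp [hk, hb0]
    · rw [hbk k hk, hbk (-k) (neg_ne_zero.2 hk), hastar, Complex.star_def,
        map_div₀, map_sub, map_one, conj_ex]
      congr 3
      simp
  set I₀ := Finset.Icc (-(M : ℤ)) M with hI₀
  have hmemI : ∀ k ∈ I₀, |k| ≤ M := fun k hk => abs_le.2 (Finset.mem_Icc.1 hk)
  have hsum := summable_exp_neg_mul_abs hs0
  refine ⟨fun z => ∑ k ∈ I₀, b k * ex (k * z), (a 0).re, fun ε' => ?_, fun x => ?_, ?_, ?_⟩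
  · exact IsStripAnalytic.sum _ fun k _ => (isStripAnalytic_ex_int_mul ε' k).const_mul _
  · exact im_eq_zero_of_symmetric_sum hbstar x
  · intro z hz
    calc ‖∑ k ∈ I₀, b k * ex (k * z)‖ ≤ ∑ k ∈ I₀, ‖b k * ex (k * z)‖ := norm_sum_le _ _
      _ ≤ ∑ k ∈ I₀, Cy * Θ * Real.exp (-(s * |(k : ℝ)|)) := by
        refine Finset.sum_le_sum fun k hk => ?_
        rw [norm_mul, norm_ex]
        have h1 : Real.exp (-(2 * Real.pi * (k * z).im)) ≤ Real.exp (2 * s * |(k : ℝ)|) := by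
          rw [Real.exp_le_exp]
          have h2 : (k * z).im = k * z.im := by simp
          have h3 : -(k * z.im) ≤ |(k : ℝ)| * (y / 2) := by
            refine (neg_le_abs _).trans ?_
            rw [abs_mul]
            exact mul_le_mul_of_nonneg_left hz (abs_nonneg _)
          rw [h2, hs]
          nlinarith [Real.pi_pos]
        refine (mul_le_mul (hbbound k (hmemI k hk)) h1 (Real.exp_pos _).le
          (by positivity)).trans_eq ?_
        rw [mul_assoc, ← Real.exp_add]
        congr 2; ring
      _ = Cy * Θ * ∑ k ∈ I₀, Real.exp (-(s * |(k : ℝ)|)) := by rw [Finset.mul_sum]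
      _ ≤ Cy * Θ * expMass s := by
        refine mul_le_mul_of_nonneg_left ?_ (by positivity)
        exact hsum.sum_le_tsum _ fun k _ => (Real.exp_pos _).le
  · have ha0 : a 0 = ((a 0).re : ℂ) := by
      have := hastar 0
      rw [neg_zero, Complex.star_def] at this
      exact (Complex.conj_eq_iff_re.1 this.symm).symm
    -- The equation is solved exactly for `|k| ≤ M`, so the error is the Fourier tail of `ρ` beyond
    -- `M`.
    set R : ℝ → ℂ := fun x => ρ x - ∑ k ∈ I₀, a k * ex (k * x) with hR
    have hRx : ∀ x : ℝ, ρ x - ((a 0).re : ℂ) - (∑ k ∈ I₀, b k * ex (k * (x + ω))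
        - ∑ k ∈ I₀, b k * ex (k * x)) = R x := by
      intro x
      have h0 : (0 : ℤ) ∈ I₀ := by simp [hI₀]
      have h1 : ((a 0).re : ℂ) = ∑ k ∈ I₀, if k = 0 then a 0 else 0 := by
        rw [Finset.sum_ite_eq' I₀ 0 (fun _ => a 0), if_pos h0, ← ha0]
      rw [h1, ← Finset.sum_sub_distrib, sub_sub, ← Finset.sum_add_distrib, hR]
      congr 1
      refine Finset.sum_congr rfl fun k hk => ?_
      by_cases hk0 : k = 0
      · simp [hk0, hb0, ex_zero]
      · rw [if_neg hk0, hbk k hk0, mul_add, ex_add]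
        have := sub_ne_zero.2 (hne k hk0 (hmemI k hk))
        field_simp
        ring
    have hcterm : ∀ k ∈ I₀, Continuous fun x : ℝ => a k * ex (k * x) := fun k _ =>
      ((isStripAnalytic_ex_int_mul ε k).const_mul _).continuous_ofReal hε
    have hRc : Continuous R := hρc.sub (continuous_finsetSum _ hcterm)
    have hRp : Function.Periodic R 1 := by
      intro x
      have h2 := (IsStripAnalytic.sum I₀ fun k _ =>
        (isStripAnalytic_ex_int_mul ε k).const_mul (a k)).2 x (ofReal_mem_strip hε x)
      have h1 := hρp x
      simp only [hR]
      refine congrArg₂ _ h1 ?_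
      simpa using h2
    have hRfc : ∀ k, fc R k = if k ∈ I₀ then 0 else a k := by
      intro k
      rw [hR, fc_sub hρc (continuous_finsetSum _ hcterm), fc_sum _ hcterm]
      have : ∀ j ∈ I₀, fc (fun x : ℝ => a j * ex (j * x)) k = if j = k then a j else 0 := by
        intro j _
        rw [fc_const_mul, fc_ex_int]
        split_ifs <;> simp
      rw [Finset.sum_congr rfl this, Finset.sum_ite_eq']
      split_ifs with h
      · exact sub_self _
      · exact sub_zero _
    have hRle : ∀ k, ‖fc R k‖ ≤ Cy * Θ * Real.exp (-(s * M)) * Real.exp (-(s * |(k : ℝ)|)) := by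
      intro k
      rw [hRfc]
      split_ifs with h
      · rw [norm_zero]; positivity
      · have hk0 : k ≠ 0 := by rintro rfl; simp [hI₀] at h
        have hkM : (M : ℝ) ≤ |(k : ℝ)| := by
          by_contra hcon
          push Not at hcon
          have : |k| < (M : ℤ) := by exact_mod_cast hcon
          exact h (Finset.mem_Icc.2 (abs_le.1 this.le))
        refine (hak k hk0).trans ?_
        rw [mul_assoc (Cy * Θ), ← Real.exp_add]
        refine mul_le_mul_of_nonneg_left ?_ (by positivity)
        rw [Real.exp_le_exp]
        have := mul_le_mul_of_nonneg_left hkM hs0.le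
        have := mul_nonneg hs0.le (abs_nonneg (k : ℝ))
        linarith
    have hRsum : Summable fun k => ‖fc R k‖ :=
      Summable.of_nonneg_of_le (fun _ => norm_nonneg _) hRle (hsum.mul_left _)
    intro x
    rw [hRx]
    refine (norm_le_tsum_fc hRc hRp hRsum x).trans ?_
    refine (hRsum.tsum_le_tsum hRle (hsum.mul_left _)).trans_eq ?_
    rw [tsum_mul_left, expMass]; ring

/-! ### Approximate solutions of second order difference equations -/

theorem le_pow_mul_of_recursion {u : ℕ → ℝ} {C X η : ℝ} (hC : 0 ≤ C) (hu : ∀ n, 0 ≤ u n)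
    (h0 : u 0 ≤ X) (h1 : u 1 ≤ X) (hη : η ≤ X)
    (hrec : ∀ n, u (n + 2) ≤ C * u (n + 1) + u n + η) (n : ℕ) : u n ≤ (C + 2) ^ n * X := by
  have hX : 0 ≤ X := (hu 0).trans h0
  have hC1 : 1 ≤ C + 2 := by linarith
  have key : ∀ n, u n ≤ (C + 2) ^ n * X ∧ u (n + 1) ≤ (C + 2) ^ (n + 1) * X := by
    intro n
    induction n with
    | zero =>
      refine ⟨by simpa using h0, ?_⟩
      simp only [zero_add, pow_one]
      nlinarith
    | succ n ih =>
      refine ⟨ih.2, (hrec n).trans ?_⟩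
      have hp : (1 : ℝ) ≤ (C + 2) ^ n := one_le_pow₀ hC1
      have hp1 : (C + 2) ^ n ≤ (C + 2) ^ (n + 1) := pow_le_pow_right₀ hC1 (Nat.le_succ n)
      -- The `2` in the base provides one copy for the term `u n` and one for the error `η`.
      have e1 : (C + 2) ^ (n + 1 + 1) * X
          = C * ((C + 2) ^ (n + 1) * X) + (C + 2) ^ (n + 1) * X + (C + 2) ^ (n + 1) * X := by
        ring
      rw [e1]
      have a1 := mul_le_mul_of_nonneg_left ih.2 hC
      have a2 : (C + 2) ^ n * X ≤ (C + 2) ^ (n + 1) * X := mul_le_mul_of_nonneg_right hp1 hX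
      have a3 : X ≤ (C + 2) ^ (n + 1) * X := le_mul_of_one_le_left hX (hp.trans hp1)
      linarith [ih.1]
  exact (key n).1

/-- A `2 × 2` matrix with small determinant almost annihilates some vector of sup norm one. -/
theorem exists_almost_kernel {p q r s : ℂ} {X : ℝ} (hX : 0 ≤ X) (h : ‖p * s - q * r‖ ≤ X ^ 2) :
    ∃ a b : ℂ, ‖a‖ ≤ 1 ∧ ‖b‖ ≤ 1 ∧ (‖a‖ = 1 ∨ ‖b‖ = 1) ∧
      ‖a * p + b * q‖ ≤ X ∧ ‖a * r + b * s‖ ≤ X := by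
  -- When `p` is the larger entry of its row and exceeds `X`, the vector `(-q/p, 1)` kills that row
  -- exactly and sends the other row to the determinant divided by `p`.
  have key : ∀ p q r s : ℂ, ‖p * s - q * r‖ ≤ X ^ 2 → X < ‖p‖ → ‖q‖ ≤ ‖p‖ →
      ∃ a b : ℂ, ‖a‖ ≤ 1 ∧ ‖b‖ = 1 ∧ ‖a * p + b * q‖ ≤ X ∧ ‖a * r + b * s‖ ≤ X := by
    intro p q r s h hp hq
    have hp0 : 0 < ‖p‖ := hX.trans_lt hp
    have hpne : p ≠ 0 := norm_pos_iff.1 hp0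
    refine ⟨-q / p, 1, ?_, by simp, ?_, ?_⟩
    · rw [norm_div, norm_neg]; exact div_le_one_of_le₀ hq hp0.le
    · have : -q / p * p + 1 * q = 0 := by field_simp; ring
      rw [this, norm_zero]; exact hX
    · have : -q / p * r + 1 * s = (p * s - q * r) / p := by field_simp; ring
      rw [this, norm_div, div_le_iff₀ hp0]
      nlinarith
  by_cases hall : ‖p‖ ≤ X ∧ ‖r‖ ≤ X
  · exact ⟨1, 0, by simp, by simp, by simp, by simpa using hall.1, by simpa using hall.2⟩
  by_cases hall2 : ‖q‖ ≤ X ∧ ‖s‖ ≤ X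
  · exact ⟨0, 1, by simp, by simp, by simp, by simpa using hall2.1, by simpa using hall2.2⟩
  have hrow : (X < ‖p‖ ∨ X < ‖q‖) ∨ (X < ‖r‖ ∨ X < ‖s‖) := by
    by_contra hcon
    push Not at hcon
    exact hall ⟨hcon.1.1, hcon.2.1⟩
  rcases hrow with hr | hr
  · rcases le_total ‖q‖ ‖p‖ with hqp | hqp
    · obtain ⟨a, b, h1, h2, h3, h4⟩ := key p q r s h
        (hr.elim id fun h => h.trans_le hqp) hqp
      exact ⟨a, b, h1, h2.le, Or.inr h2, h3, h4⟩
    · obtain ⟨a, b, h1, h2, h3, h4⟩ := key q p s r (by rwa [norm_sub_rev])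
        (hr.elim (fun h => h.trans_le hqp) id) hqp
      exact ⟨b, a, h2.le, h1, Or.inl h2, by rwa [add_comm], by rwa [add_comm]⟩
  · rcases le_total ‖s‖ ‖r‖ with hqp | hqp
    · obtain ⟨a, b, h1, h2, h3, h4⟩ := key r s p q
        (by rw [norm_sub_rev, mul_comm s, mul_comm r]; exact h)
        (hr.elim id fun h => h.trans_le hqp) hqp
      exact ⟨a, b, h1, h2.le, Or.inr h2, h4, h3⟩
    · obtain ⟨a, b, h1, h2, h3, h4⟩ := key s r q p (by rwa [mul_comm s, mul_comm r])
        (hr.elim (fun h => h.trans_le hqp) id) hqp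
      exact ⟨b, a, h2.le, h1, Or.inl h2, by rwa [add_comm], by rwa [add_comm]⟩

/-- The coefficient `c` cancels in the discrete Wronskian, so each step changes it only through the
two errors, by at most `2Kη`. -/
theorem norm_wronskian_le {f h c : ℤ → ℂ} {η K : ℝ}
    (hf : ∀ m, ‖f (m + 1) + f (m - 1) - c m * f m‖ ≤ η)
    (hh : ∀ m, ‖h (m + 1) + h (m - 1) - c m * h m‖ ≤ η)
    (hfK : ∀ m, ‖f m‖ ≤ K) (hhK : ∀ m, ‖h m‖ ≤ K) (n : ℕ) :
    ‖f 1 * h 0 - f 0 * h 1‖ ≤ ‖f (n + 1) * h n - f n * h (n + 1)‖ + n * (2 * K * η) := by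
  induction n with
  | zero => simp
  | succ n ih =>
    refine ih.trans ?_
    have hη : 0 ≤ η := (norm_nonneg _).trans (hf 0)
    have e : f (n + 1) * h n - f n * h (n + 1)
        = (f ((n + 1 : ℕ) + 1) * h (n + 1 : ℕ) - f (n + 1 : ℕ) * h ((n + 1 : ℕ) + 1))
          - (f ((n : ℤ) + 1 + 1) + f ((n : ℤ) + 1 - 1) - c (n + 1) * f (n + 1)) * h (n + 1)
          + f (n + 1) * (h ((n : ℤ) + 1 + 1) + h ((n : ℤ) + 1 - 1) - c (n + 1) * h (n + 1)) := by
      push_cast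
      rw [show (n : ℤ) + 1 - 1 = n by ring]
      ring
    rw [e]
    have b1 := (norm_add_le
      ((f ((n + 1 : ℕ) + 1) * h (n + 1 : ℕ) - f (n + 1 : ℕ) * h ((n + 1 : ℕ) + 1))
          - (f ((n : ℤ) + 1 + 1) + f ((n : ℤ) + 1 - 1) - c (n + 1) * f (n + 1)) * h (n + 1))
      (f (n + 1) * (h ((n : ℤ) + 1 + 1) + h ((n : ℤ) + 1 - 1) - c (n + 1) * h (n + 1))))
    have b2 := (norm_sub_le
      (f ((n + 1 : ℕ) + 1) * h (n + 1 : ℕ) - f (n + 1 : ℕ) * h ((n + 1 : ℕ) + 1))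
      ((f ((n : ℤ) + 1 + 1) + f ((n : ℤ) + 1 - 1) - c (n + 1) * f (n + 1)) * h (n + 1)))
    rw [norm_mul (f (n + 1))] at b1
    rw [norm_mul _ (h (n + 1))] at b2
    have b3 := mul_le_mul (hf (n + 1)) (hhK (n + 1)) (norm_nonneg _) hη
    have b4 := mul_le_mul (hfK (n + 1)) (hh (n + 1)) (norm_nonneg _)
      ((norm_nonneg _).trans (hfK 0))
    push_cast at *
    linarith

/-- A quantity below both `A` and `B` is below their weighted geometric mean; this will interpolate
between growth from the origin and decay at infinity. -/
theorem le_rpow_mul_rpow {z A B t : ℝ} (hz : 0 ≤ z) (hA : z ≤ A) (hB : z ≤ B) (ht0 : 0 ≤ t)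
    (ht1 : t ≤ 1) : z ≤ A ^ t * B ^ (1 - t) := by
  rcases hz.eq_or_lt with h | h
  · rw [← h] at hA hB ⊢
    exact mul_nonneg (Real.rpow_nonneg hA _) (Real.rpow_nonneg hB _)
  · calc z = z ^ t * z ^ (1 - t) := by rw [← Real.rpow_add h]; simp
      _ ≤ _ := mul_le_mul (Real.rpow_le_rpow hz hA ht0)
        (Real.rpow_le_rpow hz hB (by linarith)) (Real.rpow_nonneg hz _)
        (Real.rpow_nonneg (hz.trans hA) _)

/-- Two exponentially decaying approximate solutions of a second order difference equation are
almost linearly dependent. -/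
theorem exists_small_combination {f h c : ℤ → ℂ} {η K C X s t : ℝ} (hK : 1 ≤ K) (hC : 0 ≤ C)
    (hX : 0 ≤ X) (hs : 0 < s) (ht0 : 0 < t) (ht : t * (Real.log (C + 2) + 2 * s) ≤ s) (n : ℕ)
    (hc : ∀ m, ‖c m‖ ≤ C)
    (hf : ∀ m, ‖f (m + 1) + f (m - 1) - c m * f m‖ ≤ η)
    (hh : ∀ m, ‖h (m + 1) + h (m - 1) - c m * h m‖ ≤ η)
    (hfK : ∀ m : ℤ, ‖f m‖ ≤ K * Real.exp (-(2 * s * |(m : ℝ)|)))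
    (hhK : ∀ m : ℤ, ‖h m‖ ≤ K * Real.exp (-(2 * s * |(m : ℝ)|)))
    (hηX : 2 * η ≤ X)
    (hw : 2 * K ^ 2 * Real.exp (-(2 * s * n)) + n * (2 * K * η) ≤ X ^ 2) :
    ∃ a b : ℂ, ‖a‖ ≤ 1 ∧ ‖b‖ ≤ 1 ∧ (‖a‖ = 1 ∨ ‖b‖ = 1) ∧
      ∀ m : ℤ, ‖a * f m + b * h m‖ ≤
        ((C + 2) * X) ^ t * (2 * K) * Real.exp (-(s * |(m : ℝ)|)) := by
  have hη : 0 ≤ η := (norm_nonneg _).trans (hf 0)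
  have hK0 : 0 ≤ K := by linarith
  have hle : ∀ m : ℤ, K * Real.exp (-(2 * s * |(m : ℝ)|)) ≤ K := fun m =>
    mul_le_of_le_one_right hK0 (by
      rw [Real.exp_le_one_iff]
      have := mul_nonneg hs.le (abs_nonneg (m : ℝ)); linarith)
  have hfK' := fun m => (hfK m).trans (hle m)
  have hhK' := fun m => (hhK m).trans (hle m)
  -- The Wronskian at `0` is compared with the one at `n`, where each product contains a factor that
  -- has already decayed.
  have hW : ‖f 0 * h 1 - h 0 * f 1‖ ≤ X ^ 2 := by
    rw [norm_sub_rev, mul_comm (h 0)]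
    refine (norm_wronskian_le hf hh hfK' hhK' n).trans (le_trans ?_ hw)
    refine add_le_add_left ?_ _
    refine (norm_sub_le _ _).trans ?_
    rw [norm_mul, norm_mul]
    have d1 := hhK n
    have d2 := hfK n
    simp only [Int.cast_natCast, Nat.abs_cast] at d1 d2
    have e1 := mul_le_mul (hfK' (n + 1)) d1 (norm_nonneg _) hK0
    have e2 := mul_le_mul d2 (hhK' (n + 1)) (norm_nonneg _) (by positivity)
    nlinarith
  obtain ⟨a, b, ha, hb, hab, h0, h1⟩ := exists_almost_kernel hX hW
  refine ⟨a, b, ha, hb, hab, ?_⟩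
  set ψ : ℤ → ℂ := fun m => a * f m + b * h m with hψ
  have hrec : ∀ m, ‖ψ (m + 1) + ψ (m - 1) - c m * ψ m‖ ≤ X := by
    intro m
    have e : ψ (m + 1) + ψ (m - 1) - c m * ψ m
        = a * (f (m + 1) + f (m - 1) - c m * f m) + b * (h (m + 1) + h (m - 1) - c m * h m) := by
      simp only [hψ]; ring
    rw [e]
    refine (norm_add_le _ _).trans ?_
    rw [norm_mul, norm_mul]
    have e1 := mul_le_mul ha (hf m) (norm_nonneg _) zero_le_one
    have e2 := mul_le_mul hb (hh m) (norm_nonneg _) zero_le_one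
    linarith
  have hfwd : ∀ m, ‖ψ (m + 1)‖ ≤ C * ‖ψ m‖ + ‖ψ (m - 1)‖ + X := by
    intro m
    have e : ψ (m + 1) = (ψ (m + 1) + ψ (m - 1) - c m * ψ m) + c m * ψ m - ψ (m - 1) := by ring
    rw [e]
    refine (norm_sub_le _ _).trans ?_
    have e1 := norm_add_le (ψ (m + 1) + ψ (m - 1) - c m * ψ m) (c m * ψ m)
    rw [norm_mul] at e1
    have e2 := mul_le_mul_of_nonneg_right (hc m) (norm_nonneg (ψ m))
    linarith [hrec m]
  have hbwd : ∀ m, ‖ψ (m - 1)‖ ≤ C * ‖ψ m‖ + ‖ψ (m + 1)‖ + X := by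
    intro m
    have e : ψ (m - 1) = (ψ (m + 1) + ψ (m - 1) - c m * ψ m) + c m * ψ m - ψ (m + 1) := by ring
    rw [e]
    refine (norm_sub_le _ _).trans ?_
    have e1 := norm_add_le (ψ (m + 1) + ψ (m - 1) - c m * ψ m) (c m * ψ m)
    rw [norm_mul] at e1
    have e2 := mul_le_mul_of_nonneg_right (hc m) (norm_nonneg (ψ m))
    linarith [hrec m]
  have hpos : ∀ n : ℕ, ‖ψ n‖ ≤ (C + 2) ^ n * X :=
    le_pow_mul_of_recursion (u := fun n : ℕ => ‖ψ n‖) hC (fun _ => norm_nonneg _) h0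
      (by simpa using h1) le_rfl fun n => by
        have := hfwd (n + 1)
        rw [show (n : ℤ) + 1 - 1 = n by ring, show (n : ℤ) + 1 + 1 = (n + 2 : ℕ) by push_cast; ring,
          show (n : ℤ) + 1 = (n + 1 : ℕ) by push_cast; ring] at this
        exact this
  -- Backwards the recursion starts from `ψ 1`, `ψ 0`, so `ψ (-n)` is reached after `n + 1` steps.
  -- This is the origin of the extra factor `C + 2` in the two-sided bound below.
  have hneg : ∀ n : ℕ, ‖ψ (1 - n)‖ ≤ (C + 2) ^ n * X :=
    le_pow_mul_of_recursion (u := fun n : ℕ => ‖ψ (1 - n)‖) hC (fun _ => norm_nonneg _)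
      (by simpa using h1) (by simpa using h0) le_rfl fun n => by
        have := hbwd (1 - (n + 1))
        rw [show 1 - ((n : ℤ) + 1) - 1 = 1 - (n + 2 : ℕ) by push_cast; ring,
          show 1 - ((n : ℤ) + 1) + 1 = 1 - n by ring,
          show 1 - ((n : ℤ) + 1) = 1 - (n + 1 : ℕ) by push_cast; ring] at this
        exact this
  have hC1 : 1 ≤ C + 2 := by linarith
  have hC0 : 0 < C + 2 := by linarith
  have hgrow : ∀ m : ℤ, ‖ψ m‖ ≤ (C + 2) * X * Real.exp (Real.log (C + 2) * |(m : ℝ)|) := by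
    intro m
    obtain ⟨n, rfl | rfl⟩ := m.eq_nat_or_neg
    · refine (hpos n).trans ?_
      simp only [Int.cast_natCast, Nat.abs_cast]
      rw [mul_comm (Real.log _), Real.exp_nat_mul, Real.exp_log hC0]
      have : 0 ≤ (C + 2) ^ n * X := by positivity
      nlinarith
    · have := hneg (n + 1)
      rw [show (1 - ((n + 1 : ℕ) : ℤ)) = -n by push_cast; ring] at this
      refine this.trans_eq ?_
      simp only [Int.cast_neg, abs_neg, Int.cast_natCast, Nat.abs_cast]
      rw [mul_comm (Real.log _), Real.exp_nat_mul, Real.exp_log hC0]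
      ring
  have hdecay : ∀ m : ℤ, ‖ψ m‖ ≤ 2 * K * Real.exp (-(2 * s * |(m : ℝ)|)) := by
    intro m
    refine (norm_add_le _ _).trans ?_
    rw [norm_mul, norm_mul]
    have e1 := mul_le_mul ha (hfK m) (norm_nonneg _) zero_le_one
    have e2 := mul_le_mul hb (hhK m) (norm_nonneg _) zero_le_one
    linarith
  have hlog : 0 ≤ Real.log (C + 2) := Real.log_nonneg hC1
  have ht1 : t ≤ 1 := by
    by_contra hcon
    push Not at hcon
    nlinarith
  intro m
  refine (le_rpow_mul_rpow (norm_nonneg _) (hgrow m) (hdecay m) ht0.le ht1).trans ?_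
  rw [Real.mul_rpow (by positivity) (Real.exp_pos _).le,
    Real.mul_rpow (by positivity) (Real.exp_pos _).le, ← Real.exp_mul, ← Real.exp_mul]
  have hA : 0 ≤ ((C + 2) * X) ^ t := Real.rpow_nonneg (by positivity) _
  have hB : (2 * K) ^ (1 - t) ≤ 2 * K := by
    conv_rhs => rw [← Real.rpow_one (2 * K)]
    exact Real.rpow_le_rpow_of_exponent_le (by linarith) (by linarith)
  -- The hypothesis on `t` says exactly that `t log(C+2) - 2s(1-t) ≤ -s`: half of the decay rate
  -- survives the interpolation.
  have hE : Real.exp (Real.log (C + 2) * |(m : ℝ)| * t)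
      * Real.exp (-(2 * s * |(m : ℝ)|) * (1 - t)) ≤ Real.exp (-(s * |(m : ℝ)|)) := by
    rw [← Real.exp_add, Real.exp_le_exp]
    have := mul_le_mul_of_nonneg_right ht (abs_nonneg (m : ℝ))
    nlinarith
  calc _ = ((C + 2) * X) ^ t * (2 * K) ^ (1 - t) * (Real.exp (Real.log (C + 2) * |(m : ℝ)| * t)
      * Real.exp (-(2 * s * |(m : ℝ)|) * (1 - t))) := by ring
    _ ≤ ((C + 2) * X) ^ t * (2 * K) * Real.exp (-(s * |(m : ℝ)|)) := by
      refine mul_le_mul (mul_le_mul_of_nonneg_left hB hA) hE (by positivity) (by positivity)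

/-! ### Bounds for the transfer matrices, for `B` and for the multiplier -/

open scoped Matrix.Norms.L2Operator in
theorem norm_entry_le_l2_opNorm {m n : ℕ} (A : Matrix (Fin m) (Fin n) ℂ) (i : Fin m) (j : Fin n) :
    ‖A i j‖ ≤ ‖A‖ := by
  have h := A.l2_opNorm_mulVec (EuclideanSpace.single j 1)
  rw [PiLp.norm_single, norm_one, mul_one] at h
  refine le_trans ?_ h
  refine le_trans (le_of_eq ?_) (PiLp.norm_apply_le _ i)
  congr 1
  simp [EuclideanSpace.single]

open scoped Matrix.Norms.L2Operator in
theorem norm_entry_le_of_stripNorm_le {m n : ℕ} {ε K : ℝ} (hK : 0 ≤ K)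
    {F : ℂ → Matrix (Fin m) (Fin n) ℂ} (h : stripNorm ε F ≤ ENNReal.ofReal K) {z : ℂ}
    (hz : z ∈ strip ε) (i : Fin m) (j : Fin n) : ‖F z i j‖ ≤ K := by
  refine (norm_entry_le_l2_opNorm (F z) i j).trans ?_
  have h1 := (le_iSup₂ (f := fun z (_ : z ∈ strip ε) => _) z hz).trans h
  rwa [← ofReal_norm, ENNReal.ofReal_le_ofReal_iff hK] at h1

theorem norm_two_cos_le {ε : ℝ} {z : ℂ} (hz : z ∈ strip ε) :
    ‖2 * Complex.cos (2 * Real.pi * z)‖ ≤ 2 * Real.exp (2 * Real.pi * ε) := by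
  have hz' : |z.im| ≤ ε := le_of_lt hz
  have h1 : 2 * Complex.cos (2 * Real.pi * z) = ex z + ex (-z) := by
    rw [Complex.two_cos, ex, ex]; congr 2 <;> ring
  have key : ∀ w : ℂ, |w.im| ≤ ε → ‖ex w‖ ≤ Real.exp (2 * Real.pi * ε) := by
    intro w hw
    rw [norm_ex, Real.exp_le_exp]
    have := (neg_le_abs w.im).trans hw
    nlinarith [Real.pi_pos]
  rw [h1]
  refine (norm_add_le _ _).trans ?_
  have := key z hz'
  have := key (-z) (by simpa using hz')
  linarith

/-- The transfer matrices are uniformly bounded on the strip, for bounded energies. -/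
theorem exists_norm_transfer_mulVec_le (d : ℕ) (v : ℤ → ℂ) (ε E₀ : ℝ) :
    ∃ C : ℝ, 0 ≤ C ∧ ∀ E : ℝ, |E| ≤ E₀ → ∀ z ∈ strip ε, ∀ x : Fin (d + d) → ℂ,
      ‖(transfer d v E z).mulVec x‖ ≤ C * ‖x‖ := by
  have hsum : 0 ≤ ∑ j : Fin (d + d), ‖v ((d : ℤ) - 1 - (j : ℕ))‖ :=
    Finset.sum_nonneg fun _ _ => norm_nonneg _
  -- The summand `1` covers the subdiagonal entries, the quotient those of the first row.
  set A := (|E₀| + 2 * Real.exp (2 * Real.pi * ε)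
    + ∑ j : Fin (d + d), ‖v ((d : ℤ) - 1 - (j : ℕ))‖) / ‖v d‖ + 1 with hA
  have hA0 : 0 ≤ A := by positivity
  refine ⟨(d + d : ℕ) * A, by positivity, fun E hE z hz x => ?_⟩
  have hentry : ∀ i j, ‖transfer d v E z i j‖ ≤ A := by
    intro i j
    simp only [transfer, Matrix.of_apply]
    split_ifs with h1 h2 h3
    · rw [norm_div]
      refine le_trans ?_ (le_add_of_nonneg_right zero_le_one)
      gcongr
      refine (norm_sub_le _ _).trans (add_le_add ((norm_sub_le _ _).trans
        (add_le_add ?_ (norm_two_cos_le hz))) ?_)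
      · rw [Complex.norm_real]; exact hE.trans (le_abs_self _)
      · exact Finset.single_le_sum (f := fun j : Fin (d + d) => ‖v ((d : ℤ) - 1 - (j : ℕ))‖)
          (fun _ _ => norm_nonneg _) (Finset.mem_univ j)
    · rw [norm_div]
      refine le_trans ?_ (le_add_of_nonneg_right zero_le_one)
      gcongr
      rw [zero_sub, norm_neg]
      refine le_trans (Finset.single_le_sum
        (f := fun j : Fin (d + d) => ‖v ((d : ℤ) - 1 - (j : ℕ))‖)
          (fun _ _ => norm_nonneg _) (Finset.mem_univ j)) ?_
      exact le_add_of_nonneg_left (by positivity)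
    · rw [norm_one, hA]
      exact le_add_of_nonneg_left (by positivity)
    · rw [norm_zero]; exact hA0
  refine (pi_norm_le_iff_of_nonneg (by positivity)).2 fun i => ?_
  rw [Matrix.mulVec, dotProduct]
  refine (norm_sum_le _ _).trans ?_
  calc ∑ j, ‖transfer d v E z i j * x j‖ ≤ ∑ _j : Fin (d + d), A * ‖x‖ := by
        refine Finset.sum_le_sum fun j _ => ?_
        rw [norm_mul]
        exact mul_le_mul (hentry i j) (norm_le_pi_norm x j) (norm_nonneg _) hA0
    _ = _ := by
        rw [Finset.sum_const, Finset.card_univ, Fintype.card_fin, nsmul_eq_mul]; ring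

/-- The total mass of the entries of the form `S_d`. -/
def formMass (d : ℕ) (v : ℤ → ℂ) : ℝ := ∑ a, ∑ b, ‖formS d v a b‖

theorem formMass_nonneg (d : ℕ) (v : ℤ → ℂ) : 0 ≤ formMass d v :=
  Finset.sum_nonneg fun _ _ => Finset.sum_nonneg fun _ _ => norm_nonneg _

/-- The identity `B(x)^* S B(x) = J` continues to the strip. -/
theorem conjTranspose_star_mul_formS_mul {d : ℕ} {v : ℤ → ℂ} {ε : ℝ} (hε : 0 < ε)
    {B : ℂ → Matrix (Fin (d + d)) (Fin 2) ℂ} (hB : ∀ i j, IsStripAnalytic ε fun z => B z i j)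
    (hH : ∀ x : ℝ, B x ∈ HSp d v) {z : ℂ} (hz : z ∈ strip ε) :
    (B (star z)).conjTranspose * formS d v * B z = formJ := by
  ext i j
  -- Evaluating the adjoint factor at the conjugate point makes the left side holomorphic, so the
  -- identity theorem applies.
  have key := eqOn_strip_of_eq_on_real hε
    (f := fun z => ((B (star z)).conjTranspose * formS d v * B z) i j)
    (g := fun _ => formJ i j) ?_ (differentiableOn_const _) ?_
  · exact key hz
  · simp only [Matrix.mul_apply, Matrix.conjTranspose_apply]
    refine DifferentiableOn.fun_sum fun b _ => DifferentiableOn.mul ?_ (hB b j).1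
    refine DifferentiableOn.fun_sum fun a _ => DifferentiableOn.mul_const ?_ _
    exact differentiableOn_star_star (hB a i).1
  · intro x
    have h := hH x
    simp only [HSp, Set.mem_ofPred_eq] at h
    simp only [Complex.star_def, Complex.conj_ofReal]
    rw [h]

/-- The matrix `J` preserves the sup norm, and `J ξ` is obtained by applying `B(z̄)^* S`, which is
bounded, to `B(z) ξ`. Hence `B(z)` cannot contract `ξ` much. -/
theorem norm_le_mul_norm_mulVec {d : ℕ} {v : ℤ → ℂ} {ε K : ℝ} (hε : 0 < ε)
    {B : ℂ → Matrix (Fin (d + d)) (Fin 2) ℂ} (hB : ∀ i j, IsStripAnalytic ε fun z => B z i j)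
    (hH : ∀ x : ℝ, B x ∈ HSp d v) (hK : ∀ z ∈ strip ε, ∀ i j, ‖B z i j‖ ≤ K) {z : ℂ}
    (hz : z ∈ strip ε) (ξ : Fin 2 → ℂ) :
    ‖ξ‖ ≤ formMass d v * K * ‖(B z).mulVec ξ‖ := by
  have hK0 : 0 ≤ formMass d v * K := by
    rw [formMass, Finset.sum_mul]
    refine Finset.sum_nonneg fun a _ => ?_
    exact mul_nonneg (Finset.sum_nonneg fun _ _ => norm_nonneg _)
      ((norm_nonneg _).trans (hK z hz a 0))
  have hid := conjTranspose_star_mul_formS_mul hε hB hH hz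
  have hJ : ∀ i, ‖formJ.mulVec ξ i‖ ≤ formMass d v * K * ‖(B z).mulVec ξ‖ := by
    intro i
    rw [← hid, ← Matrix.mulVec_mulVec, ← Matrix.mulVec_mulVec, Matrix.mulVec, dotProduct]
    refine (norm_sum_le _ _).trans ?_
    rw [formMass, Finset.sum_mul, Finset.sum_mul]
    refine Finset.sum_le_sum fun a _ => ?_
    rw [norm_mul, Matrix.conjTranspose_apply, norm_star]
    have h1 : ‖(formS d v).mulVec ((B z).mulVec ξ) a‖ ≤
        (∑ b, ‖formS d v a b‖) * ‖(B z).mulVec ξ‖ := by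
      rw [Matrix.mulVec, dotProduct]
      refine (norm_sum_le _ _).trans ?_
      rw [Finset.sum_mul]
      refine Finset.sum_le_sum fun b _ => ?_
      rw [norm_mul]
      exact mul_le_mul_of_nonneg_left (norm_le_pi_norm _ b) (norm_nonneg _)
    refine (mul_le_mul (hK _ (star_mem_strip hz) a i) h1 (norm_nonneg _)
      ((norm_nonneg _).trans (hK z hz a 0))).trans_eq ?_
    ring
  refine (pi_norm_le_iff_of_nonneg (by positivity)).2 fun i => ?_
  have h0 := hJ 0
  have h1 := hJ 1
  simp only [formJ, Matrix.mulVec, dotProduct, Fin.sum_univ_two, Matrix.of_apply, Matrix.cons_val',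
    Matrix.cons_val_zero, Matrix.cons_val_one, Matrix.cons_val_fin_one, zero_mul, one_mul, zero_add,
    neg_mul, add_zero, norm_neg] at h0 h1
  fin_cases i
  · exact h1
  · exact h0

/-- Bounds for the Birkhoff sums of `Im ρ` when `e(ρ)` is almost the multiplier of a bounded
cocycle along a section that is bounded above and below. -/
theorem abs_im_birkhoff_le {V : Type*} [NormedAddCommGroup V] [NormedSpace ℂ V] {ε C P η ω : ℝ}
    (hε : 0 < ε) (hC : 0 ≤ C) (hP : 1 ≤ P) (hη : P * η ≤ 1) {ρ : ℂ → ℂ}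
    (hρ : IsStripAnalytic ε ρ) (hreal : ∀ x : ℝ, (ρ x).im = 0) {b b' : ℂ → V}
    (hbP : ∀ z ∈ strip ε, ‖b z‖ ≤ P) (hbP' : ∀ z ∈ strip ε, 1 ≤ P * ‖b z‖)
    (hb' : ∀ z ∈ strip ε, ‖b' z‖ ≤ C * ‖b z‖)
    (herr : ∀ z ∈ strip ε, ‖b' z - ex (ρ z) • b (z + ω)‖ ≤ η) (j : ℕ) {z : ℂ} (hz : z ∈ strip ε) :
    |(∑ i ∈ Finset.range j, ρ (z + (i * ω : ℝ))).im| ≤ j * Real.log (C + 1) + 2 * Real.log P := by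
  have hP0 : 0 < P := by linarith
  have hbpos : ∀ z ∈ strip ε, 0 < ‖b z‖ := fun z hz => by
    by_contra hcon
    have := hbP' z hz
    nlinarith [norm_nonneg (b z)]
  have hD : 0 < C + 1 := by linarith
  have hstep : ∀ z ∈ strip ε, -(2 * Real.pi * (ρ z).im) ≤
      Real.log (C + 1) + Real.log ‖b z‖ - Real.log ‖b (z + ω)‖ := by
    intro z hz
    have hzω := add_ofReal_mem_strip hz ω
    have h1 : Real.exp (-(2 * Real.pi * (ρ z).im)) * ‖b (z + ω)‖ ≤ (C + 1) * ‖b z‖ := by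
      rw [← norm_ex, ← norm_smul]
      have h2 : ‖ex (ρ z) • b (z + ω)‖ ≤ ‖b' z‖ + η := by
        have := norm_sub_norm_le (ex (ρ z) • b (z + ω)) (b' z)
        rw [norm_sub_rev] at this
        linarith [herr z hz]
      -- As `P η ≤ 1 ≤ P ‖b z‖`, the error is absorbed into `‖b z‖`, turning `C` into `C + 1`. The
      -- resulting logarithmic inequality telescopes along the orbit.
      have h3 : η ≤ ‖b z‖ := by
        have h4 : P * η ≤ P * ‖b z‖ := hη.trans (hbP' z hz)
        exact le_of_mul_le_mul_left h4 hP0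
      linarith [hb' z hz]
    have h5 := Real.log_le_log (mul_pos (Real.exp_pos _) (hbpos _ hzω)) h1
    rw [Real.log_mul (Real.exp_pos _).ne' (hbpos _ hzω).ne', Real.log_exp,
      Real.log_mul hD.ne' (hbpos _ hz).ne'] at h5
    linarith
  have hlogP : 0 ≤ Real.log P := Real.log_nonneg hP
  have hlogD : 0 ≤ Real.log (C + 1) := Real.log_nonneg (by linarith)
  have hup : ∀ z ∈ strip ε, Real.log ‖b z‖ ≤ Real.log P := fun z hz =>
    Real.log_le_log (hbpos z hz) (hbP z hz)
  have hlo : ∀ z ∈ strip ε, -Real.log P ≤ Real.log ‖b z‖ := fun z hz => by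
    have := Real.log_le_log one_pos (hbP' z hz)
    rw [Real.log_one, Real.log_mul hP0.ne' (hbpos z hz).ne'] at this
    linarith
  have hsum : ∀ z ∈ strip ε, ∀ j : ℕ,
      -(2 * Real.pi * (∑ i ∈ Finset.range j, ρ (z + (i * ω : ℝ))).im) ≤
      j * Real.log (C + 1) + Real.log ‖b z‖ - Real.log ‖b (z + (j * ω : ℝ))‖ := by
    intro z hz j
    induction j with
    | zero => simp
    | succ j ih =>
      rw [Finset.sum_range_succ, Complex.add_im]
      have h1 := hstep _ (add_ofReal_mem_strip hz (j * ω))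
      have h2 : z + ((j * ω : ℝ) : ℂ) + ω = z + (((j + 1 : ℕ) * ω : ℝ) : ℂ) := by push_cast; ring
      rw [h2] at h1
      push_cast at *
      linarith
  have hone : ∀ z ∈ strip ε, -(∑ i ∈ Finset.range j, ρ (z + (i * ω : ℝ))).im ≤
      j * Real.log (C + 1) + 2 * Real.log P := by
    intro z hz
    have h1 := hsum z hz j
    have h2 := hup z hz
    have h3 := hlo _ (add_ofReal_mem_strip hz (j * ω))
    have h4 : 0 ≤ j * Real.log (C + 1) + 2 * Real.log P := by positivity
    have hpi : 3 < Real.pi := Real.pi_gt_three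
    by_contra hcon
    push Not at hcon
    nlinarith
  -- The cocycle is bounded only from above, which gives one sign; reflection `z ↦ z̄` reverses the
  -- sign of `Im ρ` and gives the other.
  have hconj : (∑ i ∈ Finset.range j, ρ (star z + (i * ω : ℝ))).im
      = -(∑ i ∈ Finset.range j, ρ (z + (i * ω : ℝ))).im := by
    rw [Complex.im_sum, Complex.im_sum, ← Finset.sum_neg_distrib]
    refine Finset.sum_congr rfl fun i _ => ?_
    have : star z + ((i * ω : ℝ) : ℂ) = star (z + ((i * ω : ℝ) : ℂ)) := by
      simp only [star_add, Complex.star_def, Complex.conj_ofReal]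
    rw [this, star_eq_of_real hε hρ.1 hreal (add_ofReal_mem_strip hz _), Complex.star_def,
      Complex.conj_im]
  have h1 := hone z hz
  have h2 := hone _ (star_mem_strip hz)
  rw [hconj] at h2
  exact abs_le.2 ⟨by linarith, by linarith⟩

/-! ### Aubry duality -/

/-- The total mass of the coefficients entering the dual equation. -/
def coeffMass (d : ℕ) (v : ℤ → ℂ) : ℝ :=
  ∑ j ∈ Finset.range (d + d), ‖v ((d : ℤ) - 1 - (j : ℕ))‖ + ‖v d‖

theorem coeffMass_nonneg (d : ℕ) (v : ℤ → ℂ) : 0 ≤ coeffMass d v := by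
  unfold coeffMass; positivity

/-- The coefficient `E - ∑_{|k| ≤ d} v_k μ^k` of the dual equation. -/
def dualCoeff (d : ℕ) (v : ℤ → ℂ) (E : ℝ) (μ : ℂ) : ℂ :=
  E - ∑ j ∈ Finset.range (d + d), v ((d : ℤ) - 1 - (j : ℕ)) * μ ^ ((d : ℤ) - 1 - (j : ℕ))
    - v d * μ ^ (d : ℤ)

theorem norm_dualCoeff_le (d : ℕ) (v : ℤ → ℂ) {E E₀ : ℝ} (hE : |E| ≤ E₀) {μ : ℂ} (hμ : ‖μ‖ = 1) :
    ‖dualCoeff d v E μ‖ ≤ E₀ + coeffMass d v := by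
  rw [dualCoeff, coeffMass, ← add_assoc]
  refine (norm_sub_le _ _).trans (add_le_add ((norm_sub_le _ _).trans (add_le_add ?_ ?_)) ?_)
  · rwa [Complex.norm_real]
  · refine (norm_sum_le _ _).trans (Finset.sum_le_sum fun j _ => ?_)
    rw [norm_mul, norm_zpow, hμ, one_zpow, mul_one]
  · rw [norm_mul, norm_zpow, hμ, one_zpow, mul_one]

theorem norm_sub_le_of_step {G : ℕ → ℂ} {η : ℝ} {N : ℕ} (hη : 0 ≤ η)
    (h : ∀ n, n + 1 < N → ‖G n - G (n + 1)‖ ≤ η) {m n : ℕ} (hm : m < N) (hn : n < N) :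
    ‖G m - G n‖ ≤ N * η := by
  have key : ∀ m k : ℕ, m + k < N → ‖G m - G (m + k)‖ ≤ k * η := by
    intro m k
    induction k with
    | zero => intro _; simp
    | succ k ih =>
      intro hk
      have h1 := ih (by omega)
      have h2 := h (m + k) (by omega)
      have h3 := norm_sub_le_norm_sub_add_norm_sub (G m) (G (m + k)) (G (m + k + 1))
      rw [← add_assoc]
      push_cast
      linarith
  rcases le_total m n with hmn | hmn
  · obtain ⟨k, rfl⟩ := Nat.exists_eq_add_of_le hmn
    refine (key m k hn).trans ?_
    have : (k : ℝ) ≤ N := by exact_mod_cast (by omega : k ≤ N)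
    gcongr
  · obtain ⟨k, rfl⟩ := Nat.exists_eq_add_of_le hmn
    rw [norm_sub_rev]
    refine (key n k hm).trans ?_
    have : (k : ℝ) ≤ N := by exact_mod_cast (by omega : k ≤ N)
    gcongr

/-- Aubry duality: the Fourier coefficients of an almost invariant section of the transfer cocycle
almost solve the dual second order difference equation. -/
theorem norm_dual_equation_le {d : ℕ} (hd : 1 ≤ d) {v : ℤ → ℂ} (hv : v d ≠ 0) {E ω η : ℝ} {l : ℂ}
    (hl : ‖l‖ = 1) {U : ℕ → ℝ → ℂ} (hc : ∀ n, Continuous (U n))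
    (hp : ∀ n, Function.Periodic (U n) 1)
    (hstep : ∀ n, n + 1 < d + d → ∀ x, ‖U n x - l * U (n + 1) (x + ω)‖ ≤ η)
    (hrow : ∀ x : ℝ, ‖∑ j ∈ Finset.range (d + d),
      ((if j + 1 = d then (E : ℂ) - 2 * Complex.cos (2 * Real.pi * x) else 0)
        - v ((d : ℤ) - 1 - (j : ℕ))) / v d * U j x - l * U 0 (x + ω)‖ ≤ η) (m : ℤ) :
    ‖fc (U (d - 1)) (m + 1) + fc (U (d - 1)) (m - 1)
      - dualCoeff d v E (l * ex (m * ω)) * fc (U (d - 1)) m‖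
      ≤ ((d + d : ℕ) + 1) * coeffMass d v * η := by
  have hη : 0 ≤ η := (norm_nonneg _).trans (hrow 0)
  set μ := l * ex (m * ω) with hμdef
  have hμ : ‖μ‖ = 1 := by
    rw [hμdef, norm_mul, hl, one_mul, norm_ex_of_im_eq_zero (by simp)]
  have hμ0 : μ ≠ 0 := by rw [← norm_pos_iff, hμ]; exact one_pos
  set F : ℕ → ℂ := fun n => fc (U n) m with hF
  have hshiftc : ∀ n, Continuous fun x => U n (x + ω) := fun n => (hc n).comp (by fun_prop)
  have hshift : ∀ n, fc (fun x => l * U n (x + ω)) m = μ * F n := by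
    intro n
    rw [fc_const_mul, fc_comp_add (hp n), hμdef]; ring
  have hFstep : ∀ n, n + 1 < d + d → ‖F n - μ * F (n + 1)‖ ≤ η := by
    intro n hn
    have c4 : Continuous fun x => l * U (n + 1) (x + ω) := continuous_const.mul (hshiftc _)
    rw [← hshift, hF, ← fc_sub (hc n) c4]
    exact norm_fc_le (hstep n hn) m
  -- Translation by `ω` multiplies the `m`-th coefficient by `e(mω)`, so the shift rows read `F n ≈
  -- μ F (n+1)`. All components are thus expressed through the one of index `d - 1`, the component
  -- multiplied by the cosine.
  have hG : ∀ n, n < d + d →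
      ‖F n - μ ^ ((d : ℤ) - 1 - n) * F (d - 1)‖ ≤ (d + d : ℕ) * η := by
    intro n hn
    have h1 := norm_sub_le_of_step (G := fun n => μ ^ n * F n) (N := d + d) hη (fun n hn => by
      have : μ ^ n * F n - μ ^ (n + 1) * F (n + 1) = μ ^ n * (F n - μ * F (n + 1)) := by ring
      rw [this, norm_mul, norm_pow, hμ, one_pow, one_mul]
      exact hFstep n hn) hn (show d - 1 < d + d by omega)
    refine le_trans (le_of_eq ?_) h1
    have e : F n - μ ^ ((d : ℤ) - 1 - n) * F (d - 1)
        = μ ^ (-(n : ℤ)) * (μ ^ n * F n - μ ^ (d - 1) * F (d - 1)) := by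
      have e1 : μ ^ ((d : ℤ) - 1 - n) = μ ^ (-(n : ℤ)) * μ ^ (d - 1) := by
        rw [← zpow_natCast μ (d - 1), ← zpow_add₀ hμ0]
        congr 1; push_cast [Nat.cast_sub hd]; ring
      have e2 : μ ^ (-(n : ℤ)) * μ ^ n = 1 := by
        rw [zpow_neg, zpow_natCast, inv_mul_cancel₀ (pow_ne_zero _ hμ0)]
      rw [e1, mul_sub, ← mul_assoc, e2, one_mul, ← mul_assoc]
    rw [e, norm_mul, norm_zpow, hμ, one_zpow, one_mul]
  have hd1 : d - 1 ∈ Finset.range (d + d) := Finset.mem_range.2 (by omega)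
  -- the first row, multiplied by `v d`
  set R : ℝ → ℂ := fun x => (E * U (d - 1) x - (ex ((1 : ℤ) * x) * U (d - 1) x
      + ex ((-1 : ℤ) * x) * U (d - 1) x))
      - ∑ j ∈ Finset.range (d + d), v ((d : ℤ) - 1 - (j : ℕ)) * U j x
      - v d * (l * U 0 (x + ω)) with hR
  have hRle : ∀ x, ‖R x‖ ≤ ‖v d‖ * η := by
    intro x
    have e : R x = v d * (∑ j ∈ Finset.range (d + d),
      ((if j + 1 = d then (E : ℂ) - 2 * Complex.cos (2 * Real.pi * x) else 0)
        - v ((d : ℤ) - 1 - (j : ℕ))) / v d * U j x - l * U 0 (x + ω)) := by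
      rw [mul_sub, Finset.mul_sum]
      have e1 : ∀ j ∈ Finset.range (d + d), v d *
          (((if j + 1 = d then (E : ℂ) - 2 * Complex.cos (2 * Real.pi * x) else 0)
            - v ((d : ℤ) - 1 - (j : ℕ))) / v d * U j x)
          = (if j = d - 1 then ((E : ℂ) - 2 * Complex.cos (2 * Real.pi * x)) * U j x else 0)
            - v ((d : ℤ) - 1 - (j : ℕ)) * U j x := by
        intro j _
        have : j + 1 = d ↔ j = d - 1 := by omega
        simp only [this]
        split_ifs <;> field_simp
        ring
      rw [Finset.sum_congr rfl e1, Finset.sum_sub_distrib, Finset.sum_ite_eq' _ (d - 1), if_pos hd1]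
      have e2 : 2 * Complex.cos (2 * Real.pi * x) = ex ((1 : ℤ) * x) + ex ((-1 : ℤ) * x) := by
        rw [Complex.two_cos, ex, ex]; congr 2 <;> (push_cast; ring)
      rw [e2, hR]
      ring
    rw [e, norm_mul]
    exact mul_le_mul_of_nonneg_left (hrow x) (norm_nonneg _)
  have hexc : ∀ k : ℤ, Continuous fun x : ℝ => ex (k * x) := fun k =>
    (isStripAnalytic_ex_int_mul 1 k).continuous_ofReal one_pos
  -- Multiplication by `2 cos(2πx) = e(x) + e(-x)` shifts the frequency by `±1`, which produces the
  -- second order operator in `m`.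
  have hfcR : fc R m = (E * F (d - 1) - (fc (U (d - 1)) (m - 1) + fc (U (d - 1)) (m + 1)))
      - ∑ j ∈ Finset.range (d + d), v ((d : ℤ) - 1 - (j : ℕ)) * F j - v d * (μ * F 0) := by
    have c1 : Continuous fun x => (E : ℂ) * U (d - 1) x := continuous_const.mul (hc _)
    have c2 : ∀ k : ℤ, Continuous fun x : ℝ => ex (k * x) * U (d - 1) x :=
      fun k => (hexc k).mul (hc _)
    have c3 : ∀ j ∈ Finset.range (d + d),
        Continuous fun x => v ((d : ℤ) - 1 - (j : ℕ)) * U j x :=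
      fun j _ => continuous_const.mul (hc _)
    have c4 : Continuous fun x => l * U 0 (x + ω) := continuous_const.mul (hshiftc _)
    have c5 : Continuous fun x => v d * (l * U 0 (x + ω)) := continuous_const.mul c4
    have c22 : Continuous fun x : ℝ => ex ((1 : ℤ) * x) * U (d - 1) x
        + ex ((-1 : ℤ) * x) * U (d - 1) x := (c2 1).add (c2 (-1))
    have c12 : Continuous fun x : ℝ => (E : ℂ) * U (d - 1) x - (ex ((1 : ℤ) * x) * U (d - 1) x
        + ex ((-1 : ℤ) * x) * U (d - 1) x) := c1.sub c22
    have c123 : Continuous fun x : ℝ => (E : ℂ) * U (d - 1) x - (ex ((1 : ℤ) * x) * U (d - 1) x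
        + ex ((-1 : ℤ) * x) * U (d - 1) x)
        - ∑ j ∈ Finset.range (d + d), v ((d : ℤ) - 1 - (j : ℕ)) * U j x :=
      c12.sub (continuous_finsetSum _ c3)
    rw [hR, fc_sub c123 c5, fc_sub c12 (continuous_finsetSum _ c3), fc_sub c1 c22,
      fc_add (c2 1) (c2 (-1)), fc_sum _ c3, fc_const_mul,
      fc_const_mul, hshift, fc_mul_ex_int, fc_mul_ex_int, sub_neg_eq_add]
    simp only [fc_const_mul, hF]
  have hfcRle : ‖fc R m‖ ≤ ‖v d‖ * η := norm_fc_le hRle m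
  have e : fc (U (d - 1)) (m + 1) + fc (U (d - 1)) (m - 1) - dualCoeff d v E μ * fc (U (d - 1)) m
      = -fc R m - (∑ j ∈ Finset.range (d + d), v ((d : ℤ) - 1 - (j : ℕ)) *
          (F j - μ ^ ((d : ℤ) - 1 - (j : ℕ)) * F (d - 1))
        + v d * μ * (F 0 - μ ^ ((d : ℤ) - 1 - ((0 : ℕ) : ℤ)) * F (d - 1))) := by
    -- The row carries the coefficients `v_k` for `k` from `d - 1` down to `-d`; the missing top
    -- term `v_d μ^d` comes from the right side `l U 0 (x + ω)`.
    have hz : μ ^ (d : ℤ) = μ * μ ^ ((d : ℤ) - 1 - ((0 : ℕ) : ℤ)) := by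
      rw [← zpow_one_add₀ hμ0]; congr 1; push_cast; ring
    rw [hfcR, dualCoeff, hz]
    simp only [mul_sub, Finset.sum_sub_distrib]
    have : ∑ j ∈ Finset.range (d + d), v ((d : ℤ) - 1 - (j : ℕ)) *
          (μ ^ ((d : ℤ) - 1 - (j : ℕ)) * F (d - 1))
        = (∑ j ∈ Finset.range (d + d), v ((d : ℤ) - 1 - (j : ℕ)) *
          μ ^ ((d : ℤ) - 1 - (j : ℕ))) * F (d - 1) := by
      rw [Finset.sum_mul]
      exact Finset.sum_congr rfl fun j _ => by ring
    rw [this, hF]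
    ring
  rw [e]
  have b1 : ‖∑ j ∈ Finset.range (d + d), v ((d : ℤ) - 1 - (j : ℕ)) *
      (F j - μ ^ ((d : ℤ) - 1 - (j : ℕ)) * F (d - 1))‖ ≤
      (∑ j ∈ Finset.range (d + d), ‖v ((d : ℤ) - 1 - (j : ℕ))‖) * ((d + d : ℕ) * η) := by
    refine (norm_sum_le _ _).trans ?_
    rw [Finset.sum_mul]
    refine Finset.sum_le_sum fun j hj => ?_
    rw [norm_mul]
    exact mul_le_mul_of_nonneg_left (hG j (Finset.mem_range.1 hj)) (norm_nonneg _)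
  have b2 : ‖v d * μ * (F 0 - μ ^ ((d : ℤ) - 1 - ((0 : ℕ) : ℤ)) * F (d - 1))‖
      ≤ ‖v d‖ * ((d + d : ℕ) * η) := by
    rw [norm_mul, norm_mul, hμ, mul_one]
    exact mul_le_mul_of_nonneg_left (hG 0 (by omega)) (norm_nonneg _)
  have b3 : ‖v d‖ * η ≤ coeffMass d v * η := by
    refine mul_le_mul_of_nonneg_right ?_ hη
    exact le_add_of_nonneg_left (Finset.sum_nonneg fun _ _ => norm_nonneg _)
  refine (norm_sub_le _ _).trans ?_
  rw [norm_neg]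
  refine (add_le_add hfcRle ((norm_add_le _ _).trans (add_le_add b1 b2))).trans ?_
  have e3 : ((d + d : ℕ) + 1 : ℝ) * coeffMass d v * η = coeffMass d v * η
      + ((∑ j ∈ Finset.range (d + d), ‖v ((d : ℤ) - 1 - (j : ℕ))‖) * ((d + d : ℕ) * η)
      + ‖v d‖ * ((d + d : ℕ) * η)) := by
    rw [coeffMass]; ring
  rw [e3]
  linarith

/-- All components of an almost invariant section are controlled by one of them. -/
theorem norm_component_le {U : ℕ → ℝ → ℂ} {l : ℂ} (hl : ‖l‖ = 1) {η ω Y : ℝ} {N p : ℕ} (hp : p < N)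
    (hη : 0 ≤ η) (hstep : ∀ n, n + 1 < N → ∀ x, ‖U n x - l * U (n + 1) (x + ω)‖ ≤ η)
    (hY : ∀ x, ‖U p x‖ ≤ Y) {n : ℕ} (hn : n < N) (x : ℝ) : ‖U n x‖ ≤ Y + N * η := by
  have hsub : ∀ n, n + 1 < N → ∀ x, ‖U n x‖ ≤ ‖U (n + 1) (x + ω)‖ + η ∧
      ‖U (n + 1) x‖ ≤ ‖U n (x - ω)‖ + η := by
    intro n hn x
    constructor
    · have h1 := norm_sub_norm_le (U n x) (l * U (n + 1) (x + ω))
      rw [norm_mul, hl, one_mul] at h1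
      linarith [hstep n hn x]
    · have h1 := norm_sub_norm_le (l * U (n + 1) (x - ω + ω)) (U n (x - ω))
      rw [norm_mul, hl, one_mul, norm_sub_rev, sub_add_cancel] at h1
      have := hstep n hn (x - ω)
      rw [sub_add_cancel] at this
      linarith
  have hup : ∀ k, p + k < N → ∀ x, ‖U (p + k) x‖ ≤ Y + k * η := by
    intro k
    induction k with
    | zero => intro _ x; simpa using hY x
    | succ k ih =>
      intro hk x
      have h1 := (hsub (p + k) hk x).2
      have h2 := ih (by omega) (x - ω)
      rw [← add_assoc]
      push_cast
      linarith
  have hdown : ∀ k, k ≤ p → ∀ x, ‖U (p - k) x‖ ≤ Y + k * η := by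
    intro k
    induction k with
    | zero => intro _ x; simpa using hY x
    | succ k ih =>
      intro hk x
      have e : p - (k + 1) + 1 = p - k := by omega
      have h1 := (hsub (p - (k + 1)) (by omega) x).1
      rw [e] at h1
      have h2 := ih (by omega) (x + ω)
      push_cast
      linarith
  have hmono : ∀ k : ℕ, k ≤ N → Y + k * η ≤ Y + N * η := fun k hk => by
    have : (k : ℝ) ≤ N := by exact_mod_cast hk
    gcongr
  rcases le_total p n with h | h
  · have := hup (n - p) (by omega) x
    rw [show p + (n - p) = n by omega] at this
    exact this.trans (hmono _ (by omega))
  · have := hdown (p - n) (by omega) x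
    rw [show p - (p - n) = n by omega] at this
    exact this.trans (hmono _ (by omega))

theorem transfer_mul_succ {d : ℕ} (v : ℤ → ℂ) (E : ℝ) (z : ℂ)
    (A : Matrix (Fin (d + d)) (Fin 2) ℂ) {n : ℕ} (hn : n + 1 < d + d) (j : Fin 2) :
    (transfer d v E z * A) ⟨n + 1, hn⟩ j = A ⟨n, by omega⟩ j := by
  rw [Matrix.mul_apply, Finset.sum_eq_single ⟨n, by omega⟩]
  · simp [transfer]
  · intro b _ hb
    have : n ≠ (b : ℕ) := fun h => hb (Fin.ext h.symm)
    simp [transfer, this]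
  · simp

theorem transfer_mul_zero {d : ℕ} (v : ℤ → ℂ) (E : ℝ) (z : ℂ)
    (A : Matrix (Fin (d + d)) (Fin 2) ℂ) (h0 : 0 < d + d) (j : Fin 2) :
    (transfer d v E z * A) ⟨0, h0⟩ j = ∑ k : Fin (d + d),
      ((if (k : ℕ) + 1 = d then (E : ℂ) - 2 * Complex.cos (2 * Real.pi * z) else 0)
        - v ((d : ℤ) - 1 - (k : ℕ))) / v d * A k j := by
  rw [Matrix.mul_apply]
  simp [transfer]

/-- A two dimensional almost invariant section with constant multiplier that extends to a strip
has to be almost degenerate. -/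
theorem one_le_of_gauged_section {d : ℕ} (hd : 1 ≤ d) {v : ℤ → ℂ} (hv : v d ≠ 0)
    {ε s E E₀ ω η K P X t : ℝ} (hs : 0 < s) (hsε : s < Real.pi * ε) (hE : |E| ≤ E₀)
    (hK : 1 ≤ K) (hP : 0 ≤ P) (hX : 0 ≤ X) (ht0 : 0 < t)
    (ht : t * (Real.log (E₀ + coeffMass d v + 2) + 2 * s) ≤ s)
    {l : ℂ} (hl : ‖l‖ = 1) {A : ℂ → Matrix (Fin (d + d)) (Fin 2) ℂ}
    (hA : ∀ i j, IsStripAnalytic ε fun z => A z i j)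
    (hAK : ∀ z : ℂ, |z.im| ≤ s / Real.pi → ∀ i j, ‖A z i j‖ ≤ K)
    (hAP : ∀ (x : ℝ) (ξ : Fin 2 → ℂ), ‖ξ‖ ≤ P * ‖(A x).mulVec ξ‖)
    (herr : ∀ (x : ℝ) i j, ‖(transfer d v E x * A x) i j - l * A (x + ω) i j‖ ≤ η) (n : ℕ)
    (hηX : 2 * (((d + d : ℕ) + 1) * coeffMass d v * η) ≤ X)
    (hw : 2 * K ^ 2 * Real.exp (-(2 * s * n))
      + n * (2 * K * (((d + d : ℕ) + 1) * coeffMass d v * η)) ≤ X ^ 2) :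
    1 ≤ P * (((E₀ + coeffMass d v + 2) * X) ^ t * (2 * K) * expMass s
      + (d + d : ℕ) * (2 * η)) := by
  have hπ := Real.pi_pos
  have hε : 0 < ε := by nlinarith
  have hη : 0 ≤ η := (norm_nonneg _).trans (herr 0 ⟨0, by omega⟩ 0)
  have hE₀ : 0 ≤ E₀ := (abs_nonneg _).trans hE
  have hm := coeffMass_nonneg d v
  -- Extension by zero to all natural indices avoids arithmetic in `Fin (d + d)`; only indices below
  -- `d + d` matter.
  set U : Fin 2 → ℕ → ℝ → ℂ := fun j n x => if h : n < d + d then A x ⟨n, h⟩ j else 0 with hU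
  have hUlt : ∀ j n (h : n < d + d) x, U j n x = A x ⟨n, h⟩ j := fun j n h x => dif_pos h
  have hc : ∀ j n, Continuous (U j n) := by
    intro j n
    by_cases h : n < d + d
    · simpa only [hU, dif_pos h] using (hA ⟨n, h⟩ j).continuous_ofReal hε
    · simpa only [hU, dif_neg h] using continuous_const
  have hp : ∀ j n, Function.Periodic (U j n) 1 := by
    intro j n x
    by_cases h : n < d + d
    · simpa only [hU, dif_pos h, ofReal_add, ofReal_one] using
        (hA ⟨n, h⟩ j).2 x (ofReal_mem_strip hε x)
    · simp only [hU, dif_neg h]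
  have hstep : ∀ j n, n + 1 < d + d → ∀ x, ‖U j n x - l * U j (n + 1) (x + ω)‖ ≤ η := by
    intro j n hn x
    have := herr x ⟨n + 1, hn⟩ j
    rw [transfer_mul_succ] at this
    rw [hUlt j n (by omega), hUlt j (n + 1) hn, ofReal_add]
    exact this
  have hrow : ∀ (j : Fin 2) (x : ℝ), ‖∑ k ∈ Finset.range (d + d),
      ((if k + 1 = d then (E : ℂ) - 2 * Complex.cos (2 * Real.pi * x) else 0)
        - v ((d : ℤ) - 1 - (k : ℕ))) / v d * U j k x - l * U j 0 (x + ω)‖ ≤ η := by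
    intro j x
    have := herr x ⟨0, by omega⟩ j
    rw [transfer_mul_zero] at this
    rw [Finset.sum_range, hUlt j 0 (by omega), ofReal_add]
    convert this using 5 with k
    exact hUlt j k k.2 x
  have hd1 : d - 1 < d + d := by omega
  set f : Fin 2 → ℤ → ℂ := fun j => fc (U j (d - 1)) with hf
  -- The half-width `s/π` corresponds to the decay rate `2s`, twice the rate left after
  -- interpolation.
  have hdecay : ∀ j m, ‖f j m‖ ≤ K * Real.exp (-(2 * s * |(m : ℝ)|)) := by
    intro j m
    have h1 := norm_fc_le_of_strip (hA ⟨d - 1, hd1⟩ j) (y := s / Real.pi) (by positivity)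
      (by rw [div_lt_iff₀ hπ]; linarith) (fun z hz => hAK z hz _ _) m
    have h2 : f j = fc (fun x : ℝ => A x ⟨d - 1, hd1⟩ j) := by
      simp only [hf]; congr 1; ext x; exact hUlt j _ hd1 x
    rw [h2]
    refine h1.trans_eq ?_
    congr 2; field_simp
  obtain ⟨a, b, ha, hb, hab, hsmall⟩ := exists_small_combination (f := f 0) (h := f 1)
    (c := fun m => dualCoeff d v E (l * ex (m * ω))) hK (by linarith : 0 ≤ E₀ + coeffMass d v) hX hs
    ht0 ht n
    (fun m => norm_dualCoeff_le d v hE (by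
      rw [norm_mul, hl, one_mul, norm_ex_of_im_eq_zero (by simp)]))
    (fun m => norm_dual_equation_le hd hv hl (hc 0) (hp 0) (hstep 0) (hrow 0) m)
    (fun m => norm_dual_equation_le hd hv hl (hc 1) (hp 1) (hstep 1) (hrow 1) m)
    (hdecay 0) (hdecay 1) hηX hw
  set Z := ((E₀ + coeffMass d v + 2) * X) ^ t * (2 * K) with hZ
  set W : ℕ → ℝ → ℂ := fun n x => a * U 0 n x + b * U 1 n x with hW
  have hWp : ∀ x, ‖W (d - 1) x‖ ≤ Z * expMass s := by
    have c0 : ∀ (a : ℂ) j, Continuous fun x => a * U j (d - 1) x :=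
      fun a j => continuous_const.mul (hc j _)
    have hWc : Continuous (W (d - 1)) := (c0 a 0).add (c0 b 1)
    have hWper : Function.Periodic (W (d - 1)) 1 := by
      intro x; simp only [hW, hp 0 (d - 1) x, hp 1 (d - 1) x]
    have hfcW : ∀ m, fc (W (d - 1)) m = a * f 0 m + b * f 1 m := by
      intro m
      simp only [hW]
      rw [fc_add (c0 a 0) (c0 b 1), fc_const_mul, fc_const_mul]
    have hle : ∀ m : ℤ, ‖fc (W (d - 1)) m‖ ≤ Z * Real.exp (-(s * |(m : ℝ)|)) := by
      intro m; rw [hfcW]; exact hsmall m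
    have hsum := (summable_exp_neg_mul_abs hs).mul_left Z
    have hsumW : Summable fun m => ‖fc (W (d - 1)) m‖ :=
      Summable.of_nonneg_of_le (fun _ => norm_nonneg _) hle hsum
    intro x
    refine (norm_le_tsum_fc hWc hWper hsumW x).trans ?_
    refine (hsumW.tsum_le_tsum hle hsum).trans_eq ?_
    rw [tsum_mul_left, expMass]
  have hWstep : ∀ n, n + 1 < d + d → ∀ x, ‖W n x - l * W (n + 1) (x + ω)‖ ≤ 2 * η := by
    intro n hn x
    have e : W n x - l * W (n + 1) (x + ω) = a * (U 0 n x - l * U 0 (n + 1) (x + ω))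
        + b * (U 1 n x - l * U 1 (n + 1) (x + ω)) := by simp only [hW]; ring
    rw [e]
    refine (norm_add_le _ _).trans ?_
    rw [norm_mul, norm_mul]
    have e1 := mul_le_mul ha (hstep 0 n hn x) (norm_nonneg _) zero_le_one
    have e2 := mul_le_mul hb (hstep 1 n hn x) (norm_nonneg _) zero_le_one
    linarith
  have hnorm : (1 : ℝ) ≤ ‖(![a, b] : Fin 2 → ℂ)‖ := by
    rcases hab with h | h
    · rw [← h]; exact norm_le_pi_norm (![a, b] : Fin 2 → ℂ) 0
    · rw [← h]; exact norm_le_pi_norm (![a, b] : Fin 2 → ℂ) 1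
  -- The lower bound is tested on `ξ = (a, b)` at the single point `x = 0`; the other components are
  -- reached from the small one along the shift rows.
  refine hnorm.trans ((hAP 0 ![a, b]).trans (mul_le_mul_of_nonneg_left ?_ hP))
  refine (pi_norm_le_iff_of_nonneg ?_).2 fun i => ?_
  · have := expMass_nonneg s
    positivity
  · have h1 := norm_component_le hl hd1 (by linarith : 0 ≤ 2 * η) hWstep hWp i.2 0
    refine le_trans (le_of_eq ?_) h1
    congr 1
    simp only [hW, hUlt 0 i i.2, hUlt 1 i i.2, Matrix.mulVec, dotProduct, Fin.sum_univ_two]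
    simp
    ring

/-! ### Reduction to a constant multiplier -/

theorem norm_ex_sub_one_le {z : ℂ} (hz : z.im = 0) : ‖ex z - 1‖ ≤ 2 * Real.pi * ‖z‖ := by
  have h1 : z = (z.re : ℂ) := by apply Complex.ext <;> simp [hz]
  have h2 := Real.norm_exp_I_mul_ofReal_sub_one_le (x := 2 * Real.pi * z.re)
  have h3 : ex z = Complex.exp (I * ((2 * Real.pi * z.re : ℝ) : ℂ)) := by
    rw [ex]; conv_lhs => rw [h1]
    congr 1; push_cast; ring
  rw [h3]
  refine h2.trans_eq ?_
  conv_rhs => rw [h1]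
  rw [Complex.norm_real, norm_mul, Real.norm_of_nonneg (by positivity)]

/-- The bound for the gauge that makes the multiplier constant. -/
def gaugeBound (ε Θ : ℝ) : ℝ :=
  2 / (1 - Real.exp (-(4 * Real.pi * (ε / 2)))) * Θ * expMass (Real.pi * (ε / 2) / 2)

/-- Replacing `B` by `e(g) B` makes the multiplier the constant `e(a₀)` up to a small error. On the
real line `e(g)` is unimodular, so the lower bound is unchanged; only the bound on the smaller strip
costs a factor `e^{2πG}`. The conclusion is kept as a numerical inequality, to be refuted by a
choice of parameters. -/
theorem one_le_of_almostConjugate {d : ℕ} (hd : 1 ≤ d) {v : ℤ → ℂ} (hv : v d ≠ 0)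
    {ε E E₀ ω η K C X t Θ τ : ℝ} (hε : 0 < ε) (hE : |E| ≤ E₀) (hη : 0 ≤ η)
    (hK : 1 ≤ K) (hX : 0 ≤ X) (ht0 : 0 < t)
    (ht : t * (Real.log (E₀ + coeffMass d v + 2) + 2 * (Real.pi * (ε / 2) / 2))
      ≤ Real.pi * (ε / 2) / 2) (hC0 : 0 ≤ C)
    (hC : ∀ z ∈ strip ε, ∀ x : Fin (d + d) → ℂ, ‖(transfer d v E z).mulVec x‖ ≤ C * ‖x‖)
    (h : AlmostConjugate d v E ω ε η K) {N M K₀ : ℕ} (hN : 0 < N) (hτ : 0 < τ)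
    (hPη : (formMass d v + 1) * K * η ≤ 1)
    (hΘ : N * Real.log (C + 1) + 2 * Real.log ((formMass d v + 1) * K) ≤ Θ)
    (hdiv : ∀ k : ℤ, k ≠ 0 → |k| ≤ M → τ ≤ N * ‖ex (k * ω) - 1‖)
    (hlow : ∀ k : ℤ, k ≠ 0 → |k| ≤ K₀ → 4 < N * ‖ex (k * ω) - 1‖)
    (hK₀ : 2 / τ * Real.exp (-(Real.pi * (ε / 2) / 2 * K₀)) ≤ 1)
    {K₁ η₁ : ℝ} (hK₁ : Real.exp (2 * Real.pi * gaugeBound ε Θ) * K ≤ K₁)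
    (hη₁ : η + 2 * Real.pi * (gaugeBound ε Θ * Real.exp (-(Real.pi * (ε / 2) / 2 * M))) * K ≤ η₁)
    (n : ℕ) (hηX : 2 * (((d + d : ℕ) + 1) * coeffMass d v * η₁) ≤ X)
    (hw : 2 * K₁ ^ 2 * Real.exp (-(2 * (Real.pi * (ε / 2) / 2) * n))
      + n * (2 * K₁ * (((d + d : ℕ) + 1) * coeffMass d v * η₁)) ≤ X ^ 2) :
    1 ≤ (formMass d v + 1) * K *
      (((E₀ + coeffMass d v + 2) * X) ^ t * (2 * K₁) * expMass (Real.pi * (ε / 2) / 2)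
      + (d + d : ℕ) * (2 * η₁)) := by
  obtain ⟨ρ, B, hρ, hρr, hB, hH, herr, hBK⟩ := h
  have hπ := Real.pi_pos
  have hK0 : 0 ≤ K := by linarith
  have hF := formMass_nonneg d v
  have hBK' : ∀ z ∈ strip ε, ∀ i j, ‖B z i j‖ ≤ K := fun z hz i j =>
    norm_entry_le_of_stripNorm_le hK0 hBK hz i j
  have herr' : ∀ z ∈ strip ε, ∀ i j,
      ‖(transfer d v E z * B z) i j - ex (ρ z) * B (z + ω) i j‖ ≤ η := by
    intro z hz i j
    have h1 := norm_entry_le_of_stripNorm_le hη herr hz i j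
    have h2 : (B (z + ω) * (Complex.exp (2 * Real.pi * Complex.I * ρ z) •
        (1 : Matrix (Fin 2) (Fin 2) ℂ))) i j = ex (ρ z) * B (z + ω) i j := by
      rw [Matrix.mul_smul, Matrix.mul_one, Matrix.smul_apply, smul_eq_mul, ex]
    rwa [Matrix.sub_apply, h2] at h1
  set P := (formMass d v + 1) * K with hPdef
  have hP1 : 1 ≤ P := by rw [hPdef]; nlinarith
  have hFP : formMass d v * K ≤ P := by rw [hPdef]; nlinarith
  have hKP : K ≤ P := by rw [hPdef]; nlinarith
  have hlower : ∀ z ∈ strip ε, ∀ ξ : Fin 2 → ℂ, ‖ξ‖ ≤ P * ‖(B z).mulVec ξ‖ := fun z hz ξ =>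
    (norm_le_mul_norm_mulVec hε hB hH hBK' hz ξ).trans
      (mul_le_mul_of_nonneg_right hFP (norm_nonneg _))
  -- the Birkhoff sums of `ρ`
  have hbirk : ∀ j ≤ N, ∀ z : ℂ, |z.im| ≤ ε / 2 →
      |(∑ i ∈ Finset.range j, ρ (z + (i * ω : ℝ))).im| ≤ Θ := by
    intro j hj z hz
    have hz' : z ∈ strip ε := lt_of_le_of_lt hz (by linarith)
    -- The first column alone is enough to control the multiplier.
    have hcol : ∀ z, (B z).mulVec (Pi.single 0 1) = fun i => B z i 0 := fun z => by
      ext i; simp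
    refine (abs_im_birkhoff_le hε hC0 hP1 hPη hρ hρr (b := fun z => (fun i => B z i 0))
      (b' := fun z => (transfer d v E z).mulVec fun i => B z i 0) (ω := ω)
      (fun z hz => (pi_norm_le_iff_of_nonneg (by linarith)).2 fun i => (hBK' z hz i 0).trans hKP)
      (fun z hz => ?_) (fun z hz => hC z hz _) (fun z hz => ?_) j hz').trans ?_
    · have := hlower z hz (Pi.single 0 1)
      rw [hcol, Pi.norm_single, norm_one] at this
      exact this
    · exact (pi_norm_le_iff_of_nonneg hη).2 fun i => herr' z hz i 0
    · have : (j : ℝ) ≤ N := by exact_mod_cast hj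
      have := mul_le_mul_of_nonneg_right this (Real.log_nonneg (by linarith : 1 ≤ C + 1))
      linarith
  obtain ⟨g, a₀, hg, hgr, hgb, hgR⟩ := exists_gauge (by linarith : 0 < ε / 2) (by linarith) hρ hρr ω
    hN hτ hbirk hdiv hlow hK₀
  change ∀ z : ℂ, |z.im| ≤ ε / 2 / 2 → ‖g z‖ ≤ gaugeBound ε Θ at hgb
  change ∀ x : ℝ, _ ≤ gaugeBound ε Θ * Real.exp (-(Real.pi * (ε / 2) / 2 * M)) at hgR
  set G := gaugeBound ε Θ with hG
  have hG0 : 0 ≤ G := (norm_nonneg _).trans (hgb 0 (by simp; positivity))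
  have hK₁1 : 1 ≤ K₁ := by
    refine le_trans ?_ hK₁
    have : 1 ≤ Real.exp (2 * Real.pi * G) := Real.one_le_exp (by positivity)
    nlinarith
  set s := Real.pi * (ε / 2) / 2 with hs
  have hs0 : 0 < s := by positivity
  have hgx : ∀ x : ℝ, ‖ex (g x)‖ = 1 := fun x => norm_ex_of_im_eq_zero (hgr x)
  refine one_le_of_gauged_section hd hv (ε := ε) (s := s) (E := E) (ω := ω) (l := ex a₀)
    (A := fun z => ex (g z) • B z) hs0 (by rw [hs]; nlinarith) hE hK₁1 (by linarith) hX ht0 ht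
    (norm_ex_ofReal _) (fun i j => ?_) (fun z hz i j => ?_) (fun x ξ => ?_) (fun x i j => ?_) n
    hηX hw
  · simpa using (hg ε).ex_comp.mul (hB i j)
  · have hz2 : |z.im| ≤ ε / 2 / 2 := by
      refine hz.trans_eq ?_
      rw [hs]; field_simp
    have hz' : z ∈ strip ε := lt_of_le_of_lt hz2 (by linarith)
    rw [Matrix.smul_apply, smul_eq_mul, norm_mul]
    refine le_trans (mul_le_mul ?_ (hBK' z hz' i j) (norm_nonneg _) (Real.exp_pos _).le) hK₁
    rw [norm_ex, Real.exp_le_exp]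
    have h1 : -(g z).im ≤ G := (neg_le_abs _).trans ((Complex.abs_im_le_norm _).trans (hgb z hz2))
    nlinarith
  · rw [Matrix.smul_mulVec, norm_smul, hgx, one_mul]
    exact hlower x (ofReal_mem_strip hε x) ξ
  · set R := ρ x - a₀ - (g (x + ω) - g x) with hR
    have hRim : R.im = 0 := by
      have h1 := hgr (x + ω)
      rw [ofReal_add] at h1
      simp [hR, hρr, hgr, h1]
    have hexp : ex (g x) * ex (ρ x) = ex a₀ * ex (g (x + ω)) * ex R := by
      rw [← ex_add, ← ex_add, ← ex_add]; congr 1; rw [hR]; ring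
    have e : (transfer d v E x * ex (g x) • B x) i j - ex a₀ * (ex (g (x + ω)) • B (x + ω)) i j
        = ex (g x) * ((transfer d v E x * B x) i j - ex (ρ x) * B (x + ω) i j)
          + ex a₀ * ex (g (x + ω)) * (ex R - 1) * B (x + ω) i j := by
      rw [Matrix.mul_smul, Matrix.smul_apply, Matrix.smul_apply, smul_eq_mul, smul_eq_mul]
      linear_combination (B (x + ω) i j) * hexp
    have hgω := hgx (x + ω)
    rw [ofReal_add] at hgω
    rw [e]
    refine (norm_add_le _ _).trans (le_trans (add_le_add ?_ ?_) hη₁)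
    · rw [norm_mul, hgx, one_mul]
      exact herr' x (ofReal_mem_strip hε x) i j
    · rw [norm_mul, norm_mul, norm_mul, hgω, norm_ex_ofReal, one_mul, one_mul]
      refine mul_le_mul ?_ (hBK' _ (add_ofReal_mem_strip (ofReal_mem_strip hε x) ω) i j)
        (norm_nonneg _) (by positivity)
      exact (norm_ex_sub_one_le hRim).trans (mul_le_mul_of_nonneg_left (hgR x) (by positivity))

/-! ### Choice of the constants -/

theorem eventually_mul_exp_neg_le_one (A : ℝ) {a : ℝ} (ha : 0 < a) :
    ∀ᶠ x : ℝ in Filter.atTop, A * (x * Real.exp (-(a * x))) ≤ 1 := by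
  have h1 := (tendsto_rpow_mul_exp_neg_mul_atTop_nhds_zero 1 a ha).const_mul A
  rw [mul_zero] at h1
  filter_upwards [h1.eventually (eventually_le_nhds one_pos)] with x hx
  simpa [neg_mul] using hx

/-- The preceding bound carries a factor `x` to absorb terms linear in `q`; where only a constant
has to be absorbed, the factor is dropped. -/
theorem mul_exp_neg_le_one {A a x : ℝ} (hA : 0 ≤ A) (hx : 1 ≤ x)
    (h : A * (x * Real.exp (-(a * x))) ≤ 1) : A * Real.exp (-(a * x)) ≤ 1 := by
  refine le_trans (mul_le_mul_of_nonneg_left ?_ hA) h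
  exact le_mul_of_one_le_left (Real.exp_pos _).le hx

theorem gaugeBound_mul (ε Θ : ℝ) : gaugeBound ε Θ = gaugeBound ε 1 * Θ := by
  unfold gaugeBound; ring

theorem gaugeBound_nonneg {ε Θ : ℝ} (hε : 0 < ε) (hΘ : 0 ≤ Θ) : 0 ≤ gaugeBound ε Θ := by
  unfold gaugeBound
  have h1 : 0 < 1 - Real.exp (-(4 * Real.pi * (ε / 2))) := by
    rw [sub_pos, Real.exp_lt_one_iff]
    have : 0 < 4 * Real.pi * (ε / 2) := by positivity
    linarith
  have := expMass_nonneg (Real.pi * (ε / 2) / 2)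
  positivity

set_option maxHeartbeats 1000000 in
/-- Nonexistence of almost conjugacies, for every frequency with the arithmetic properties of a
convergent of large denominator `q`. -/
theorem exists_forall_not_almostConjugate {d : ℕ} (hd : 1 ≤ d) {v : ℤ → ℂ} (hv : v d ≠ 0)
    {ε c : ℝ} (hε : 0 < ε) (hc : 0 < c) (E₀ : ℝ) :
    ∃ (δ : ℝ) (K₀ : ℕ), 0 < δ ∧ ∀ γ : ℝ, 0 < γ → ∃ Q : ℝ, ∀ q : ℕ, Q < q → ∀ ω : ℝ,
      (∀ k : ℤ, k ≠ 0 → |k| ≤ K₀ → γ ≤ ‖ex (k * ω) - 1‖) →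
      (∀ k : ℤ, k ≠ 0 → |k| ≤ (q / 2 : ℕ) → 1 / (q : ℝ) ≤ ‖ex (k * ω) - 1‖) →
      ∀ E : ℝ, |E| ≤ E₀ →
        ¬ AlmostConjugate d v E ω ε (Real.exp ((-c + δ) * q)) (Real.exp (δ * q)) := by
  obtain ⟨C, hC0, hC⟩ := exists_norm_transfer_mulVec_le d v ε E₀
  have hπ := Real.pi_pos
  set s := Real.pi * (ε / 2) / 2 with hs
  have hs0 : 0 < s := by positivity
  set cm := coeffMass d v with hcm
  have hcm0 : 0 ≤ cm := coeffMass_nonneg d v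
  set F := formMass d v + 1 with hF
  have hF1 : 1 ≤ F := by have := formMass_nonneg d v; linarith
  set T := expMass s with hT
  have hT0 : 0 ≤ T := expMass_nonneg s
  set A := Real.log (C + 1) with hA
  have hA0 : 0 ≤ A := Real.log_nonneg (by linarith)
  -- With `N ≤ 2κx` and `2 log F ≤ κx`, the Birkhoff bound is at most `κ(2A + 3)x`. As `gaugeBound`
  -- is linear in `Θ`, the gauge is at most `κΓx` with `Γ` independent of `κ`.
  set Γ := gaugeBound ε 1 * (2 * A + 3) with hΓ
  have hΓ0 : 0 ≤ Γ := mul_nonneg (gaugeBound_nonneg hε zero_le_one) (by linarith)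
  set lg := Real.log (E₀ + cm + 2) with hlg
  -- The absolute value keeps the denominator positive, as no sign of `E₀` is known yet.
  set t := s / (|lg| + 2 * s) with htdef
  have hden : 0 < |lg| + 2 * s := by positivity
  have ht0 : 0 < t := by positivity
  have ht1 : t ≤ 1 := by
    rw [htdef, div_le_one hden]
    have := abs_nonneg lg
    linarith
  have ht : t * (lg + 2 * s) ≤ s := by
    calc t * (lg + 2 * s) ≤ t * (|lg| + 2 * s) :=
          mul_le_mul_of_nonneg_left (by linarith [le_abs_self lg]) ht0.le
      _ = s := by rw [htdef]; field_simp
  -- A common rate below those of the two errors: `c` for the almost conjugacy and `s/2` for the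
  -- Fourier tail beyond `q/2`.
  set c₁ := min c s / 8 with hc₁
  have hc₁0 : 0 < c₁ := by have := lt_min hc hs0; positivity
  have hc₁c : 8 * c₁ ≤ c := by rw [hc₁]; linarith [min_le_left c s]
  have hc₁s : 8 * c₁ ≤ s := by rw [hc₁]; linarith [min_le_right c s]
  -- With `X = e^{-c₁x/4}` one gets `X^t = e^{-4δ₁x}`, which beats the product of `e^{κx}` and
  -- `e^{δ₁x}`.
  set δ₁ := c₁ * t / 16 with hδ₁
  have hδ₁0 : 0 < δ₁ := by positivity
  have hδ₁c : δ₁ ≤ c₁ / 16 := by rw [hδ₁]; nlinarith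
  -- Chosen so that the gauged section is bounded by `e^{2πκΓx} e^{κx} = e^{δ₁x}`. The same `κ`
  -- serves as the final `δ`, as `τ`, and as the ratio of `N` to `q`.
  set κ := δ₁ / (2 * Real.pi * Γ + 1) with hκ
  have hκ0 : 0 < κ := by positivity
  have hκδ : κ * (2 * Real.pi * Γ + 1) = δ₁ := by rw [hκ]; field_simp
  have hκle : κ ≤ δ₁ := by
    have : 0 ≤ κ * (2 * Real.pi * Γ) := by positivity
    nlinarith
  -- This threshold depends only on `κ` and `s`, so it is fixed before `γ`, which depends on the
  -- frequency and on `K₀`.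
  obtain ⟨K₀, hK₀⟩ : ∃ K₀ : ℕ, 2 / κ * Real.exp (-(s * K₀)) ≤ 1 := by
    obtain ⟨x, hx1, hx⟩ := ((eventually_mul_exp_neg_le_one (2 / κ) hs0).and
      (Filter.eventually_ge_atTop 1)).exists
    refine ⟨⌈x⌉₊, le_trans ?_ (mul_exp_neg_le_one (by positivity) hx hx1)⟩
    have := Nat.le_ceil x
    gcongr
  refine ⟨κ, K₀, hκ0, fun γ hγ => ?_⟩
  set m := ((d + d : ℕ) + 1 : ℝ) * cm with hm
  have hm0 : 0 ≤ m := by positivity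
  set Ct := (E₀ + cm + 2) ^ t with hCt
  obtain ⟨Q, hQ⟩ := Filter.eventually_atTop.1
    ((eventually_mul_exp_neg_le_one F hc₁0).and
    ((eventually_mul_exp_neg_le_one 2 hc₁0).and
    ((eventually_mul_exp_neg_le_one (2 * (2 * Real.pi * (κ * Γ) * Real.exp (s / 2))) hc₁0).and
    ((eventually_mul_exp_neg_le_one (2 * m) (half_pos hc₁0)).and
    ((eventually_mul_exp_neg_le_one 4 hc₁0).and
    ((eventually_mul_exp_neg_le_one (2 * (2 * m)) (by positivity : 0 < c₁ / 4)).and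
    ((eventually_mul_exp_neg_le_one (4 * (F * Ct * 2 * T)) hδ₁0).and
    ((eventually_mul_exp_neg_le_one (4 * (F * (d + d : ℕ) * 2)) hδ₁0).and
    ((Filter.eventually_ge_atTop (max 1 (max (1 / κ) (2 * Real.log F / κ)))).and
    (Filter.eventually_gt_atTop (4 / (κ * γ))))))))))))
  refine ⟨Q, fun (q : ℕ) hq ω hlow hdiv E hE hconj => ?_⟩
  have hE₀ : 0 ≤ E₀ := (abs_nonneg _).trans hE
  obtain ⟨q1, q2, q3, q4, q5, q6, q7, q8, q9, q10⟩ := hQ (q : ℝ) hq.le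
  set x : ℝ := (q : ℝ) with hx
  have hx1 : 1 ≤ x := (le_max_left _ _).trans q9
  have hx0 : 0 < x := by linarith
  have hxκ : 1 ≤ κ * x := by
    have := ((le_max_left _ _).trans (le_max_right _ _)).trans q9
    rw [div_le_iff₀ hκ0] at this; linarith
  have hxF : 2 * Real.log F ≤ κ * x := by
    have := ((le_max_right _ _).trans (le_max_right _ _)).trans q9
    rw [div_le_iff₀ hκ0] at this; linarith
  have hCt0 : 0 ≤ Ct := Real.rpow_nonneg (by positivity) _
  replace q1 := mul_exp_neg_le_one (by linarith) hx1 q1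
  replace q2 := mul_exp_neg_le_one (by norm_num) hx1 q2
  replace q4 := mul_exp_neg_le_one (by positivity) hx1 q4
  replace q5 := mul_exp_neg_le_one (by norm_num) hx1 q5
  replace q7 := mul_exp_neg_le_one (by positivity) hx1 q7
  replace q8 := mul_exp_neg_le_one (by positivity) hx1 q8
  have r1 : κ * x ≤ δ₁ * x := mul_le_mul_of_nonneg_right hκle hx0.le
  have r2 : δ₁ * x ≤ c₁ / 16 * x := mul_le_mul_of_nonneg_right hδ₁c hx0.le
  have r3 : 8 * c₁ * x ≤ c * x := mul_le_mul_of_nonneg_right hc₁c hx0.le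
  have r4 : 8 * c₁ * x ≤ s * x := mul_le_mul_of_nonneg_right hc₁s hx0.le
  have r5 : 0 ≤ c₁ * x := by positivity
  have r6 : 0 ≤ δ₁ * x := by positivity
  -- Divisors of size `1/q` then satisfy `N ‖e - 1‖ ≥ κ`, while those bounded below by `γ` exceed
  -- `4/N` once `q` is large.
  set N := ⌈κ * x⌉₊ with hN
  have hNlo : κ * x ≤ N := Nat.le_ceil _
  have hNup : (N : ℝ) ≤ 2 * (κ * x) := by
    have := (Nat.ceil_lt_add_one (by positivity : 0 ≤ κ * x)).le
    linarith
  have hNpos : 0 < N := Nat.ceil_pos.2 (by positivity)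
  have hK1 : 1 ≤ Real.exp (κ * x) := Real.one_le_exp (by positivity)
  have hG : gaugeBound ε (κ * (2 * A + 3) * x) = κ * Γ * x := by
    rw [gaugeBound_mul, hΓ]; ring
  have hM : (x - 1) / 2 ≤ ((q / 2 : ℕ) : ℝ) := by
    have h1 : q ≤ 2 * (q / 2) + 1 := by omega
    have h2 : (q : ℝ) ≤ 2 * ((q / 2 : ℕ) : ℝ) + 1 := by exact_mod_cast h1
    linarith
  have key := one_le_of_almostConjugate hd hv (E₀ := E₀) (X := Real.exp (-(c₁ / 4 * x))) (t := t)
    (C := C) (Θ := κ * (2 * A + 3) * x) (τ := κ) (N := N) (M := q / 2) (K₀ := K₀)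
    (K₁ := Real.exp (δ₁ * x)) (η₁ := Real.exp (-(c₁ * x)))
    hε hE (Real.exp_pos _).le hK1 (Real.exp_pos _).le ht0 ht hC0 (hC E hE) hconj hNpos hκ0
    ?_ ?_ ?_ ?_ hK₀ ?_ ?_ q ?_ ?_
  · -- the final contradiction
    have hr : ((E₀ + cm + 2) * Real.exp (-(c₁ / 4 * x))) ^ t = Ct * Real.exp (-(4 * δ₁ * x)) := by
      rw [Real.mul_rpow (by positivity) (Real.exp_pos _).le, ← Real.exp_mul]
      congr 2; rw [hδ₁]; ring
    rw [hr] at key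
    have e1 : F * Real.exp (κ * x) * (Ct * Real.exp (-(4 * δ₁ * x)) * (2 * Real.exp (δ₁ * x)) * T)
        ≤ 1 / 4 := by
      have h1 : Real.exp (κ * x) * Real.exp (-(4 * δ₁ * x)) * Real.exp (δ₁ * x)
          ≤ Real.exp (-(δ₁ * x)) := by
        rw [← Real.exp_add, ← Real.exp_add, Real.exp_le_exp]
        linarith
      calc _ = F * Ct * 2 * T * (Real.exp (κ * x) * Real.exp (-(4 * δ₁ * x))
            * Real.exp (δ₁ * x)) := by ring
        _ ≤ F * Ct * 2 * T * Real.exp (-(δ₁ * x)) :=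
          mul_le_mul_of_nonneg_left h1 (by positivity)
        _ ≤ 1 / 4 := by linarith
    have e2 : F * Real.exp (κ * x) * ((d + d : ℕ) * (2 * Real.exp (-(c₁ * x)))) ≤ 1 / 4 := by
      have h1 : Real.exp (κ * x) * Real.exp (-(c₁ * x)) ≤ Real.exp (-(δ₁ * x)) := by
        rw [← Real.exp_add, Real.exp_le_exp]
        linarith
      calc _ = F * (d + d : ℕ) * 2 * (Real.exp (κ * x) * Real.exp (-(c₁ * x))) := by ring
        _ ≤ F * (d + d : ℕ) * 2 * Real.exp (-(δ₁ * x)) :=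
          mul_le_mul_of_nonneg_left h1 (by positivity)
        _ ≤ 1 / 4 := by linarith
    rw [mul_add] at key
    linarith
  · -- `P η ≤ 1`
    refine le_trans ?_ q1
    rw [mul_assoc, ← Real.exp_add]
    refine mul_le_mul_of_nonneg_left (Real.exp_le_exp.2 ?_) (by linarith)
    linarith
  · -- the Birkhoff sums
    rw [Real.log_mul (by linarith) (Real.exp_pos _).ne', Real.log_exp]
    have := mul_le_mul_of_nonneg_right hNup hA0
    linarith
  · intro k hk hkM
    have h1 := hdiv k hk hkM
    calc κ = κ * x * (1 / x) := by field_simp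
      _ ≤ N * ‖ex (k * ω) - 1‖ := mul_le_mul hNlo h1 (by positivity) (by positivity)
  · intro k hk hkK
    have h1 := hlow k hk hkK
    rw [div_lt_iff₀ (by positivity)] at q10
    have h2 : κ * x * γ ≤ N * ‖ex (k * ω) - 1‖ :=
      mul_le_mul hNlo h1 hγ.le (by positivity)
    linarith
  · rw [hG, ← Real.exp_add, Real.exp_le_exp, ← hκδ]
    apply le_of_eq; ring
  · -- the total error
    rw [hG]
    have h1 : Real.exp ((-c + κ) * x) ≤ 1 / 2 * Real.exp (-(c₁ * x)) := by
      have : Real.exp ((-c + κ) * x) ≤ Real.exp (-(c₁ * x)) * Real.exp (-(c₁ * x)) := by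
        rw [← Real.exp_add, Real.exp_le_exp]; linarith
      have := mul_le_mul_of_nonneg_right q2 (Real.exp_pos (-(c₁ * x))).le
      linarith
    have h2 : Real.exp (-(s * (q / 2 : ℕ))) * Real.exp (κ * x)
        ≤ Real.exp (s / 2) * Real.exp (-(c₁ * x)) * Real.exp (-(c₁ * x)) := by
      rw [← Real.exp_add, ← Real.exp_add, ← Real.exp_add, Real.exp_le_exp]
      have := mul_le_mul_of_nonneg_left hM hs0.le
      linarith
    calc _ = Real.exp ((-c + κ) * x) + 2 * Real.pi * (κ * Γ) * x *
          (Real.exp (-(s * (q / 2 : ℕ))) * Real.exp (κ * x)) := by ring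
      _ ≤ 1 / 2 * Real.exp (-(c₁ * x)) + 2 * Real.pi * (κ * Γ) * x *
          (Real.exp (s / 2) * Real.exp (-(c₁ * x)) * Real.exp (-(c₁ * x))) :=
        add_le_add h1 (mul_le_mul_of_nonneg_left h2 (by positivity))
      _ = 1 / 2 * Real.exp (-(c₁ * x)) + 1 / 2 * (2 * (2 * Real.pi * (κ * Γ) * Real.exp (s / 2))
          * (x * Real.exp (-(c₁ * x)))) * Real.exp (-(c₁ * x)) := by ring
      _ ≤ Real.exp (-(c₁ * x)) := by
        have := mul_le_mul_of_nonneg_right q3 (Real.exp_pos (-(c₁ * x))).le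
        linarith
  · have h1 : Real.exp (-(c₁ * x)) ≤ Real.exp (-(c₁ / 2 * x)) * Real.exp (-(c₁ / 4 * x)) := by
      rw [← Real.exp_add, Real.exp_le_exp]; linarith
    calc _ = 2 * m * Real.exp (-(c₁ * x)) := by ring
      _ ≤ 2 * m * (Real.exp (-(c₁ / 2 * x)) * Real.exp (-(c₁ / 4 * x))) :=
        mul_le_mul_of_nonneg_left h1 (by positivity)
      _ = (2 * m * Real.exp (-(c₁ / 2 * x))) * Real.exp (-(c₁ / 4 * x)) := by ring
      _ ≤ _ := mul_le_of_le_one_left (Real.exp_pos _).le q4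
  · have hX2 : Real.exp (-(c₁ / 4 * x)) ^ 2 = Real.exp (-(c₁ / 2 * x)) := by
      rw [← Real.exp_nat_mul]; congr 1; push_cast; ring
    have h1 : Real.exp (δ₁ * x) ^ 2 * Real.exp (-(2 * s * x))
        ≤ Real.exp (-(c₁ * x)) * Real.exp (-(c₁ / 2 * x)) := by
      rw [← Real.exp_nat_mul, ← Real.exp_add, ← Real.exp_add, Real.exp_le_exp]
      push_cast; linarith
    have h2 : Real.exp (δ₁ * x) * Real.exp (-(c₁ * x))
        ≤ Real.exp (-(c₁ / 4 * x)) * Real.exp (-(c₁ / 2 * x)) := by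
      rw [← Real.exp_add, ← Real.exp_add, Real.exp_le_exp]
      linarith
    rw [hX2]
    calc _ = 2 * (Real.exp (δ₁ * x) ^ 2 * Real.exp (-(2 * s * x)))
          + 2 * m * x * (Real.exp (δ₁ * x) * Real.exp (-(c₁ * x))) := by ring
      _ ≤ 2 * (Real.exp (-(c₁ * x)) * Real.exp (-(c₁ / 2 * x)))
          + 2 * m * x * (Real.exp (-(c₁ / 4 * x)) * Real.exp (-(c₁ / 2 * x))) :=
        add_le_add (mul_le_mul_of_nonneg_left h1 (by norm_num))
          (mul_le_mul_of_nonneg_left h2 (by positivity))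
      _ = 1 / 2 * (4 * Real.exp (-(c₁ * x))) * Real.exp (-(c₁ / 2 * x))
          + 1 / 2 * (2 * (2 * m) * (x * Real.exp (-(c₁ / 4 * x)))) * Real.exp (-(c₁ / 2 * x)) := by
        ring
      _ ≤ Real.exp (-(c₁ / 2 * x)) := by
        have h3 := mul_le_mul_of_nonneg_right q5 (Real.exp_pos (-(c₁ / 2 * x))).le
        have h4 := mul_le_mul_of_nonneg_right q6 (Real.exp_pos (-(c₁ / 2 * x))).le
        linarith

/-! ### Arithmetic of the convergents -/

theorem not_terminatedAt_of_irrational {α : ℝ} (hα : Irrational α) (n : ℕ) :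
    ¬ (GenContFract.of α).TerminatedAt n := by
  intro h
  obtain ⟨r, hr⟩ := (GenContFract.terminates_iff_rat α).1 ⟨n, h⟩
  exact hα ⟨r, hr.symm⟩

/-- All partial numerators are `1` and all partial denominators are integers, so the recursion stays
in the integers. -/
theorem exists_int_contsAux (α : ℝ) (n : ℕ) :
    ∃ a b : ℤ, (GenContFract.of α).contsAux n = ⟨a, b⟩ := by
  have key : ∀ n, (∃ a b : ℤ, (GenContFract.of α).contsAux n = ⟨a, b⟩) ∧
      ∃ a b : ℤ, (GenContFract.of α).contsAux (n + 1) = ⟨a, b⟩ := by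
    intro n
    induction n with
    | zero =>
      refine ⟨⟨1, 0, by simp [GenContFract.contsAux]⟩, ⌊α⌋, 1, ?_⟩
      simp [GenContFract.contsAux, GenContFract.of_h_eq_floor]
    | succ n ih =>
      refine ⟨ih.2, ?_⟩
      obtain ⟨⟨a, b, h1⟩, a', b', h2⟩ := ih
      rcases hs : (GenContFract.of α).s.get? n with _ | gp
      · rw [GenContFract.contsAux_stable_step_of_terminated hs]
        exact ⟨a', b', h2⟩
      · obtain ⟨hgp, w, hw⟩ := GenContFract.of_partNum_eq_one_and_exists_int_partDen_eq hs
        rw [GenContFract.contsAux_recurrence hs h1 h2]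
        refine ⟨w * a' + a, w * b' + b, ?_⟩
        simp [hgp, hw]
  exact (key n).1

theorem q_mono (α : ℝ) : Monotone (q α) :=
  monotone_nat_of_le_succ fun _ => GenContFract.of_den_mono

theorem one_le_q {α : ℝ} (n : ℕ) : 1 ≤ q α n := by
  refine le_trans (le_of_eq ?_) (q_mono α (Nat.zero_le n))
  simp [q]

/-- The convergents of an irrational number as reduced fractions. -/
theorem exists_reduced_conv {α : ℝ} (hα : Irrational α) (n : ℕ) :
    ∃ (a : ℤ) (b : ℕ), 0 < b ∧ q α n = b ∧ conv α n = a / b ∧ IsCoprime a (b : ℤ) ∧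
      |α - conv α n| ≤ 1 / (b : ℝ) ^ 2 := by
  obtain ⟨a, b, h⟩ := exists_int_contsAux α (n + 1)
  obtain ⟨a', b', h'⟩ := exists_int_contsAux α (n + 2)
  have hnum : ∀ m (a b : ℤ), (GenContFract.of α).contsAux (m + 1) = ⟨a, b⟩ →
      (GenContFract.of α).nums m = a ∧ (GenContFract.of α).dens m = b := by
    intro m a b h
    rw [GenContFract.num_eq_conts_a, GenContFract.den_eq_conts_b,
      GenContFract.nth_cont_eq_succ_nth_contAux, h]
    exact ⟨rfl, rfl⟩
  obtain ⟨ha, hb⟩ := hnum n a b h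
  obtain ⟨ha', hb'⟩ := hnum (n + 1) a' b' h'
  have hq : q α n = b := hb
  have hb1 : (1 : ℤ) ≤ b := by
    have := one_le_q (α := α) n
    rw [hq] at this
    exact_mod_cast this
  lift b to ℕ using by omega
  have hb0 : (0 : ℝ) < b := by exact_mod_cast (by omega : 0 < b)
  have hbR : q α n = b := by rw [hq]; simp
  have hdet := SimpContFract.determinant (s := SimpContFract.of α) (n := n)
    (not_terminatedAt_of_irrational hα n)
  change (GenContFract.of α).nums n * (GenContFract.of α).dens (n + 1)
    - (GenContFract.of α).dens n * (GenContFract.of α).nums (n + 1) = (-1) ^ (n + 1) at hdet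
  rw [ha, hb, ha', hb'] at hdet
  have hdetZ : a * b' - b * a' = (-1) ^ (n + 1) := by exact_mod_cast hdet
  refine ⟨a, b, by omega, hbR, ?_, ?_, ?_⟩
  · change (GenContFract.of α).convs n = _
    rw [GenContFract.conv_eq_num_div_den, ha, hb]; simp
  -- The determinant of two consecutive convergents is `±1`, which is a Bézout relation.
  · refine ⟨(-1) ^ (n + 1) * b', -((-1) ^ (n + 1) * a'), ?_⟩
    have : ((-1 : ℤ) ^ (n + 1)) * (-1) ^ (n + 1) = 1 := by
      rw [← mul_pow]; simp
    linear_combination ((-1) ^ (n + 1)) * hdetZ + this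
  · refine (GenContFract.abs_sub_convs_le (not_terminatedAt_of_irrational hα n)).trans ?_
    have h1 : q α n ≤ q α (n + 1) := q_mono α (Nat.le_succ n)
    change 1 / (q α n * q α (n + 1)) ≤ _
    rw [hbR] at h1 ⊢
    refine one_div_le_one_div_of_le (by positivity) ?_
    nlinarith

theorem two_mul_abs_le_norm_ex_sub_one {x : ℝ} (hx : |x| ≤ 1 / 2) : 2 * |x| ≤ ‖ex x - 1‖ := by
  have h1 : ex x = Complex.exp (I * ((2 * Real.pi * x : ℝ) : ℂ)) := by
    rw [ex]; congr 1; push_cast; ring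
  rw [h1, Complex.norm_exp_I_mul_ofReal_sub_one, norm_mul, Real.norm_eq_abs, Real.norm_eq_abs,
    abs_two]
  have hπ := Real.pi_pos
  have h2 := Real.mul_abs_le_abs_sin (x := 2 * Real.pi * x / 2) (by
    rw [abs_le] at hx ⊢
    constructor <;> nlinarith)
  have h3 : 2 / Real.pi * |2 * Real.pi * x / 2| = 2 * |x| := by
    rw [show 2 * Real.pi * x / 2 = Real.pi * x by ring, abs_mul, abs_of_pos hπ]; field_simp
  rw [h3] at h2
  have := abs_nonneg x
  linarith

/-- As `0 < |k| < b`, the fraction `ka/b` is at distance at least `1/b` from the integers. Passing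
to `ω` costs at most `|k|/b² ≤ 1/(2b)`, which is why `k` is limited to `b/2`; the bound `2|x| ≤
‖e(x) - 1‖` restores the factor two. -/
theorem one_div_le_norm_ex_sub_one {a : ℤ} {b : ℕ} (hb : 0 < b) (hab : IsCoprime a (b : ℤ)) {ω : ℝ}
    (hω : |ω - a / b| ≤ 1 / (b : ℝ) ^ 2) {k : ℤ} (hk : k ≠ 0) (hkb : |k| ≤ (b / 2 : ℕ)) :
    1 / (b : ℝ) ≤ ‖ex (k * ω) - 1‖ := by
  have hbR : (0 : ℝ) < b := by exact_mod_cast hb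
  set r := round (k * ω) with hr
  have hround := abs_sub_round (k * ω)
  have hne : k * a - r * b ≠ 0 := by
    intro h
    have h1 : (b : ℤ) ∣ k * a := ⟨r, by linarith⟩
    have h2 : (b : ℤ) ∣ k := hab.symm.dvd_of_dvd_mul_right h1
    have h3 := Int.le_of_dvd (abs_pos.2 hk) ((dvd_abs _ _).2 h2)
    omega
  have h1 : (1 : ℝ) ≤ |((k * a - r * b : ℤ) : ℝ)| := by
    have := Int.one_le_abs hne
    exact_mod_cast this
  have hkR : |(k : ℝ)| ≤ b / 2 := by
    have h2 : 2 * |k| ≤ b := by omega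
    have : (2 : ℝ) * |(k : ℝ)| ≤ b := by exact_mod_cast h2
    linarith
  have h2 : 1 / (b : ℝ) ≤ |k * ω - r| + 1 / (2 * b) := by
    have e : ((k * a - r * b : ℤ) : ℝ) / b = (k * ω - r) - k * (ω - a / b) := by
      push_cast; field_simp; ring
    have h3 : 1 / (b : ℝ) ≤ |((k * a - r * b : ℤ) : ℝ) / b| := by
      rw [abs_div, abs_of_pos hbR]
      exact div_le_div_of_nonneg_right h1 hbR.le
    rw [e] at h3
    refine h3.trans ((abs_sub _ _).trans ?_)
    refine add_le_add_right ?_ _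
    rw [abs_mul]
    refine (mul_le_mul hkR hω (abs_nonneg _) (by positivity)).trans_eq ?_
    field_simp
  have h4 := two_mul_abs_le_norm_ex_sub_one hround
  have h5 : ex ((k * ω - r : ℝ) : ℂ) = ex (k * ω) := by
    have e : (k * ω : ℂ) = ((k * ω - r : ℝ) : ℂ) + r := by push_cast; ring
    rw [e, ex_add, ex_int, mul_one]
  rw [← hr, h5] at h4
  have h6 : 1 / (2 * (b : ℝ)) = 1 / b / 2 := by field_simp
  rw [h6] at h2
  linarith

/-- Irrationality gives `e(kα) ≠ 1` for each of finitely many nonzero `k`, and continuity extends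
the bound to a neighbourhood of `α`, so that `α` and its late convergents share one `γ`. -/
theorem exists_eventually_le_norm_ex_sub_one {α : ℝ} (hα : Irrational α) (K₀ : ℕ) :
    ∃ γ : ℝ, 0 < γ ∧ ∀ᶠ ω : ℝ in nhds α, ∀ k : ℤ, k ≠ 0 → |k| ≤ K₀ →
      γ ≤ ‖ex (k * ω) - 1‖ := by
  have key : ∀ S : Finset ℤ, ∃ γ : ℝ, 0 < γ ∧ ∀ᶠ ω : ℝ in nhds α, ∀ k ∈ S, k ≠ 0 →
      γ ≤ ‖ex (k * ω) - 1‖ := by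
    intro S
    induction S using Finset.induction_on with
    | empty => exact ⟨1, one_pos, by simp⟩
    | insert k S _ ih =>
      obtain ⟨γ, hγ, h⟩ := ih
      by_cases hk : k = 0
      · refine ⟨γ, hγ, h.mono fun ω hω j hj hj0 => ?_⟩
        rcases Finset.mem_insert.1 hj with rfl | hj
        · exact absurd hk hj0
        · exact hω j hj hj0
      · have hpos : 0 < ‖ex (k * α) - 1‖ := by
          rw [norm_pos_iff, sub_ne_zero, ex, Ne, Complex.exp_eq_one_iff]
          rintro ⟨m, hm⟩
          have h2 : (k : ℂ) * α = m := by
            have hc := Complex.two_pi_I_ne_zero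
            apply mul_left_cancel₀ hc
            rw [hm]; ring
          have h3 : (k : ℝ) * α = m := by exact_mod_cast h2
          exact (hα.intCast_mul hk).ne_int m h3
        have hcont : Continuous fun ω : ℝ => ‖ex (k * ω) - 1‖ :=
          ((continuous_ex.comp (by fun_prop)).sub continuous_const).norm
        have h1 := hcont.continuousAt.eventually (lt_mem_nhds (half_lt_self hpos))
        refine ⟨min γ (‖ex (k * α) - 1‖ / 2), lt_min hγ (half_pos hpos), ?_⟩
        filter_upwards [h, h1] with ω hω hω1 j hj hj0
        rcases Finset.mem_insert.1 hj with rfl | hj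
        · exact (min_le_right _ _).trans hω1.le
        · exact (min_le_left _ _).trans (hω j hj hj0)
  obtain ⟨γ, hγ, h⟩ := key (Finset.Icc (-(K₀ : ℤ)) K₀)
  exact ⟨γ, hγ, h.mono fun ω hω k hk hkK => hω k (Finset.mem_Icc.2 (abs_le.1 hkK)) hk⟩

/-- A subsequence of the convergents along which `log q_{n+1} / q_n` is asymptotically at least
`β(α)`. -/
theorem exists_strictMono_beta (α : ℝ) (hβ : 0 < beta α) :
    ∃ φ : ℕ → ℕ, StrictMono φ ∧ ∀ b : ℝ, (b : EReal) < beta α → ∀ᶠ n in Filter.atTop,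
      Real.exp (b * q α (φ n)) < q α (φ n + 1) := by
  -- Levels `u n` increase to `β(α)`, possibly infinite, and the `n`-th chosen index exceeds the
  -- level `u n`; each level is exceeded infinitely often.
  obtain ⟨u, _, hu, hut⟩ := exists_seq_strictMono_tendsto' hβ
  obtain ⟨φ, hφ, h⟩ := Filter.extraction_forall_of_frequently fun n =>
    Filter.frequently_lt_of_lt_limsup (by isBoundedDefault) (hu n).2
  refine ⟨φ, hφ, fun b hb => ?_⟩
  filter_upwards [hut.eventually (lt_mem_nhds hb)] with n hn
  have h1 := hn.trans (h n)
  rw [EReal.coe_lt_coe_iff] at h1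
  have hq : 0 < q α (φ n) := one_pos.trans_le (one_le_q _)
  have hq1 : 0 < q α (φ n + 1) := one_pos.trans_le (one_le_q _)
  rw [lt_div_iff₀ hq] at h1
  exact (Real.lt_log_iff_exp_lt hq1).1 h1

/-- No subsequence is needed here: the arithmetic conditions hold with the same constants for `α`
and for each convergent of large enough denominator. -/
theorem exists_forall_convergent_not_almostConjugate {α : ℝ} (hα : Irrational α) {d : ℕ}
    (hd : 1 ≤ d) {v : ℤ → ℂ} (hv : v d ≠ 0) {ε c : ℝ} (hε : 0 < ε) (hc : 0 < c) (E₀ : ℝ) :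
    ∃ δ qs : ℝ, 0 < δ ∧ 0 < qs ∧ ∀ n : ℕ, qs < q α n → ∀ ω : ℝ, ω = α ∨ ω = conv α n →
      ∀ E : ℝ, |E| ≤ E₀ →
        ¬ AlmostConjugate d v E ω ε (Real.exp ((-c + δ) * q α n)) (Real.exp (δ * q α n)) := by
  obtain ⟨δ, K₀, hδ, h⟩ := exists_forall_not_almostConjugate hd hv hε hc E₀
  obtain ⟨γ, hγ, hlow⟩ := exists_eventually_le_norm_ex_sub_one hα K₀
  obtain ⟨Q, hQ⟩ := h γ hγ
  obtain ⟨n₀, hn₀⟩ := Filter.eventually_atTop.1 ((GenContFract.of_convergence α).eventually hlow)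
  refine ⟨δ, max Q (q α n₀), hδ, lt_max_of_lt_right (one_pos.trans_le (one_le_q _)), ?_⟩
  intro n hn ω hω E hE
  obtain ⟨a, b, hb, hqb, hconv, hcop, happ⟩ := exists_reduced_conv hα n
  -- Monotonicity of the denominators turns the threshold on `q` into one on the index.
  have hn0 : n₀ ≤ n := by
    by_contra hcon
    have := q_mono α (not_le.1 hcon).le
    exact absurd ((le_max_right _ _).trans_lt hn) (not_lt.2 this)
  rw [hqb] at hn ⊢
  refine hQ b ((le_max_left _ _).trans_lt hn) ω ?_ (fun k hk hkb => ?_) E hE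
  · rcases hω with rfl | rfl
    · exact hlow.self_of_nhds
    · exact hn₀ n hn0
  · refine one_div_le_norm_ex_sub_one hb hcop ?_ hk hkb
    rw [← hconv]
    rcases hω with rfl | rfl
    · exact happ
    · rw [sub_self, abs_zero]; positivity

end LongRange

end

theorem proposition7p1 (α : ℝ) (hα : Irrational α) (d : ℕ) (hd : 1 ≤ d) (v : ℤ → ℂ)
    (hv : LongRange.IsRealTrigPoly d v) (ε c : ℝ) (hε : 0 < ε) (hc : 0 < c) :
    ∃ (δ qs : ℝ) (φ : ℕ → ℕ), 0 < δ ∧ 0 < qs ∧ StrictMono φ ∧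
      (∀ n : ℕ, qs < LongRange.q α (φ n) →
        ∀ E : ℝ, |E| ≤ 3 + ⨆ x : ℝ, ‖LongRange.potential d v x‖ →
          ¬ LongRange.AlmostConjugate d v E α ε
              (Real.exp ((-c + δ) * LongRange.q α (φ n)))
              (Real.exp (δ * LongRange.q α (φ n)))) ∧
      (0 < LongRange.beta α →
        (∀ b : ℝ, (b : EReal) < LongRange.beta α → ∀ᶠ n in Filter.atTop,
          Real.exp (b * LongRange.q α (φ n)) < LongRange.q α (φ n + 1)) ∧
        (∀ n : ℕ, qs < LongRange.q α (φ n) →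
          ∀ E : ℝ, |E| ≤ 3 + ⨆ x : ℝ, ‖LongRange.potential d v x‖ →
            ¬ LongRange.AlmostConjugate d v E (LongRange.conv α (φ n)) ε
                (Real.exp ((-c + δ) * LongRange.q α (φ n)))
                (Real.exp (δ * LongRange.q α (φ n))))) := by
  obtain ⟨δ, qs, hδ, hqs, h⟩ := LongRange.exists_forall_convergent_not_almostConjugate hα hd
    hv.leading hε hc (3 + ⨆ x : ℝ, ‖LongRange.potential d v x‖)
  -- The subsequence only has to realise the limsup; without positivity of `β`, all convergents are
  -- taken.
  by_cases hβ : 0 < LongRange.beta α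
  · obtain ⟨φ, hφ, hb⟩ := LongRange.exists_strictMono_beta α hβ
    exact ⟨δ, qs, φ, hδ, hqs, hφ, fun n hn => h _ hn α (Or.inl rfl),
      fun _ => ⟨hb, fun n hn => h _ hn _ (Or.inr rfl)⟩⟩
  · exact ⟨δ, qs, id, hδ, hqs, strictMono_id, fun n hn => h _ hn α (Or.inl rfl),
      fun hcon => absurd hcon hβ⟩
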